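/- A $01*$-matrix is a matrix with entries in $\{0,1,*\}$. It is \emph{mixed} if it has a non-constant row and a non-constant column, or if it has at least two rows and at least two columns and contains the entry $*$. A \emph{$d$-division} of a matrix is a partition of its rows into $d$ nonempty sets $R_1,\dots,R_d$ of consecutive rows together with a partition of its columns into $d$ nonempty sets $C_1,\dots,C_d$ of consecutive columns, both numbered in their natural order; it is a \emph{$d$-almost mixed minor} if for all $i\neq j$ the submatrix on the rows $R_i$ and the columns $C_j$ is mixed. A finite simple graph $G$ is \emph{$d$-almost mixed free} if its vertices can be ordered as $v_1,\dots,v_n$ in such a way that the matrix $(a_{ij})_{1\le i,j\le n}$ with $a_{ii}=*$ and, for $i\ne j$, $a_{ij}=1$ if $v_iv_j$ is an edge and $a_{ij}=0$ otherwise, has no $d$-almost mixed minor. A graph has \emph{twin-width at most $t$} if there is a sequence of partitions of its vertex set that starts with the partition into singletons, ends with at most one part, and merges two parts in each step, such that for each partition of the sequence and each part $A$ of it, at most $t$ other parts $B$ of it are neither completely adjacent nor completely non-adjacent to $A$. Let $\chi$ and $\omega$ be the chromatic number and the clique number. \textbf{Theorem.} (i) For every integer $d\ge 1$ the class of $d$-almost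 mixed free graphs is polynomially $\chi$-bounded. More precisely, there are integers $k_d\ge 0$ ($d\ge 1$) with $k_d=d^{O(d)}$, i.e. $k_d\le d^{Cd}$ for all $d\ge 1$ and an absolute constant $C$, such that every $d$-almost mixed free graph $G$ satisfies $\chi(G)\le\omega(G)^{k_d}$. (ii) Consequently, for every integer $t\ge 0$ there is an integer $k_t'\ge 0$ such that every graph $G$ of twin-width at most $t$ satisfies $\chi(G)\le\omega(G)^{k_t'}$. -/

import Mathlib

universe u

namespace AlmostMixed

/-- The entries of a `01*`-matrix. -/
inductive Entry : Type
  | zero : Entry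
  | one : Entry
  | star : Entry

/-- All rows are constant. -/
def IsHorizontal {α β : Type*} (M : Matrix α β Entry) : Prop :=
  ∀ i j j', M i j = M i j'

/-- All columns are constant. -/
def IsVertical {α β : Type*} (M : Matrix α β Entry) : Prop :=
  ∀ i i' j, M i j = M i' j

/-- A matrix is mixed if it is neither horizontal nor vertical, or if it has at least two rows
and at least two columns and contains the entry `*`. -/
def IsMixed {α β : Type*} (M : Matrix α β Entry) : Prop :=
  (¬ IsHorizontal M ∧ ¬ IsVertical M) ∨
    (Nontrivial α ∧ Nontrivial β ∧ ∃ i j, M i j = Entry.star)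

/-- A partition of the linearly ordered set `Fin n` into `k` nonempty parts of consecutive
elements, indexed in their natural order: `block i` is the index of the part that contains `i`. -/
structure IntervalPartition (n k : ℕ) where
  block : Fin n → Fin k
  monotone_block : Monotone block
  surjective_block : Function.Surjective block

/-- A `k`-division of an `m × n` matrix: a row partition and a column partition, both
with `k` parts. -/
structure Division (m n k : ℕ) where
  rows : IntervalPartition m k
  cols : IntervalPartition n k

/-- The zone of the division `D` at position `(a, b)`: the submatrix on the `a`-th row block and
the `b`-th column block. -/
def Division.zone {m n k : ℕ} (D : Division m n k) (M : Matrix (Fin m) (Fin n) Entry)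
    (a b : Fin k) :
    Matrix {i : Fin m // D.rows.block i = a} {j : Fin n // D.cols.block j = b} Entry :=
  M.submatrix Subtype.val Subtype.val

/-- `D` is a `d`-almost mixed minor of `M`: all its off-diagonal zones are mixed. -/
def IsAlmostMixedMinor {m n d : ℕ} (D : Division m n d) (M : Matrix (Fin m) (Fin n) Entry) :
    Prop :=
  ∀ a b : Fin d, a ≠ b → IsMixed (D.zone M a b)

/-- `M` has no `d`-almost mixed minor. -/
def MatrixAlmostMixedFree (d : ℕ) {m n : ℕ} (M : Matrix (Fin m) (Fin n) Entry) : Prop :=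
  ∀ D : Division m n d, ¬ IsAlmostMixedMinor D M

open Classical in
/-- The adjacency matrix of `G` for the vertex ordering `v`, with `*` on the diagonal. -/
noncomputable def orderedAdjMatrix {V : Type u} (G : SimpleGraph V) {n : ℕ} (v : Fin n ≃ V) :
    Matrix (Fin n) (Fin n) Entry :=
  fun i j => if i = j then Entry.star else if G.Adj (v i) (v j) then Entry.one else Entry.zero

/-- A graph is `d`-almost mixed free if, for some ordering of its vertices, its adjacency matrix
has no `d`-almost mixed minor. -/
def GraphAlmostMixedFree (d : ℕ) {V : Type u} [Fintype V] (G : SimpleGraph V) : Prop :=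
  ∃ v : Fin (Fintype.card V) ≃ V, MatrixAlmostMixedFree d (orderedAdjMatrix G v)

/-- There is a red edge between the vertex sets `A` and `B`: some pair in `A × B` is adjacent
in `G` and some pair is not. -/
def IsRed {V : Type u} (G : SimpleGraph V) (A B : Set V) : Prop :=
  (∃ a ∈ A, ∃ b ∈ B, G.Adj a b) ∧ (∃ a ∈ A, ∃ b ∈ B, ¬ G.Adj a b)

/-- Every part of `P` has red degree at most `t` in the trigraph on the parts of `P`. -/
def RedDegreeLE {V : Type u} (G : SimpleGraph V) (P : Set (Set V)) (t : ℕ) : Prop :=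
  ∀ A ∈ P, {B ∈ P | B ≠ A ∧ IsRed G A B}.ncard ≤ t

/-- `Q` is obtained from `P` by merging two distinct parts. -/
def IsContraction {V : Type u} (P Q : Set (Set V)) : Prop :=
  ∃ A ∈ P, ∃ B ∈ P, A ≠ B ∧ Q = insert (A ∪ B) (P \ {A, B})

/-- `G` has twin-width at most `t`: there is a contraction sequence, i.e. a sequence
`P 0, …, P (|V| - 1)` of vertex partitions, which starts with the partition into singletons,
merges two parts in each step (and so ends with a single part), and along which the red degree
never exceeds `t`. -/
def TwinWidthLE {V : Type u} [Fintype V] (G : SimpleGraph V) (t : ℕ) : Prop :=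
  ∃ P : ℕ → Set (Set V),
    P 0 = Set.range (fun x : V => ({x} : Set V)) ∧
    (∀ i, i + 1 < Fintype.card V → IsContraction (P i) (P (i + 1))) ∧
    (∀ i, i < Fintype.card V → RedDegreeLE G (P i) t)

end AlmostMixed

/-! Fix a vertex ordering without a `d`-almost mixed minor. The colouring is a recursion built on
two tools.

The first is substitution. If a graph arises by iterated substitution and all quotients are
hereditarily `m ^ k`-colourable, then it is `n ^ (2 * k + 3)`-colourable, whatever the depth
(`colorableOn_of_iterated_substitution`). A module of clique number `w` is given `w ^ (2 * k + 3)`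
colours, and `exists_multicoloring` shows that the quotient can afford this.

The second is the delayed decomposition. An interval is split by its neighbours in the rest of its
parent interval, so homogeneity arrives one level late. Sorting edges by the parity of the depth
that separates them gives two iterated substitutions. An edge of a quotient, unless it meets the
minimum of the interval, spans two vertices that are distinguished by a vertex to the left or to the
right of the interval. Thus only the graphs `acrossGraph` have to be coloured
(`colorableOn_of_acrossGraph`).

Passing to such a graph is one step of a chain on the left or on the right. Two steps on one side
produce a set that is mixed with all earlier ones and with every interval spanned by a surviving
edge (`HasChain.exists_mixed`). Hence `2 * d` steps on one side give `d` consecutive pairwise mixed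
sets, that is, a `d`-almost mixed minor. The recursion therefore stops within `4 * d` steps, each of
which multiplies the exponent by 8, up to an additive constant.

For twin-width, order the vertices so that all parts of the contraction sequence are convex. When a
part first swallows a row or column block of a supposed minor, every part still meets at most 4
blocks of each kind. All other blocks of the opposite kind meet this part or a red neighbour of it,
which leaves room for at most `4 * (t + 1) + 1` blocks. -/

namespace AlmostMixed

/-- Every clique of `H` inside `A` has at most `n` vertices. -/
def CliqueBound {V : Type*} (H : SimpleGraph V) (A : Finset V) (n : ℕ) : Prop :=
  ∀ K ⊆ A, H.IsClique (K : Set V) → K.card ≤ n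

/-- The subgraph of `H` induced on `A` has a proper colouring with `N` colours. -/
def ColorableOn {V : Type*} (H : SimpleGraph V) (A : Finset V) (N : ℕ) : Prop :=
  ∃ c : V → ℕ, (∀ v ∈ A, c v < N) ∧ ∀ u ∈ A, ∀ v ∈ A, H.Adj u v → c u ≠ c v

/-! ### Colourings of induced subgraphs -/

section Basic

variable {V : Type*} {H H' : SimpleGraph V} {A B : Finset V} {n N N' : ℕ}

lemma CliqueBound.mono_set (h : CliqueBound H A n) (hB : B ⊆ A) : CliqueBound H B n :=
  fun K hK hc => h K (hK.trans hB) hc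

lemma CliqueBound.mono_graph (h : CliqueBound H A n)
    (hle : ∀ u ∈ A, ∀ v ∈ A, H'.Adj u v → H.Adj u v) : CliqueBound H' A n :=
  fun K hK hc => h K hK fun u hu v hv huv => hle u (hK hu) v (hK hv) (hc hu hv huv)

lemma ColorableOn.mono (h : ColorableOn H A N) (hN : N ≤ N') : ColorableOn H A N' := by
  obtain ⟨c, hc, hp⟩ := h
  exact ⟨c, fun v hv => (hc v hv).trans_le hN, hp⟩

lemma ColorableOn.mono_graph (h : ColorableOn H A N)
    (hle : ∀ u ∈ A, ∀ v ∈ A, H'.Adj u v → H.Adj u v) : ColorableOn H' A N := by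
  obtain ⟨c, hc, hp⟩ := h
  exact ⟨c, hc, fun u hu v hv huv => hp u hu v hv (hle u hu v hv huv)⟩

lemma colorableOn_empty : ColorableOn H ∅ N := ⟨fun _ => 0, by simp, by simp⟩

lemma colorableOn_one (h : ∀ u ∈ A, ∀ v ∈ A, ¬ H.Adj u v) : ColorableOn H A 1 :=
  ⟨fun _ => 0, by simp, fun u hu v hv huv => (h u hu v hv huv).elim⟩

lemma CliqueBound.one_le (h : CliqueBound H A n) (hA : A.Nonempty) : 1 ≤ n := by
  obtain ⟨a, ha⟩ := hA
  simpa using h {a} (by simpa using ha) (by simp)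

lemma CliqueBound.two_le [DecidableEq V] (h : CliqueBound H A n) {u v : V} (hu : u ∈ A)
    (hv : v ∈ A) (huv : H.Adj u v) : 2 ≤ n := by
  have := h {u, v} (by intro x hx; simp at hx; rcases hx with rfl | rfl <;> assumption)
    (by simp [SimpleGraph.isClique_insert, huv])
  rwa [Finset.card_pair huv.ne] at this

lemma CliqueBound.colorableOn_of_no_adj (h : CliqueBound H A n) (k : ℕ)
    (hno : ∀ u ∈ A, ∀ v ∈ A, ¬ H.Adj u v) : ColorableOn H A (n ^ k) := by
  rcases A.eq_empty_or_nonempty with rfl | hA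
  · exact colorableOn_empty
  · exact (colorableOn_one hno).mono (Nat.one_le_pow _ _ (h.one_le hA))

/-- Two vertex sets get disjoint palettes. -/
lemma ColorableOn.union [DecidableEq V] (hA : ColorableOn H A N) (hB : ColorableOn H B N') :
    ColorableOn H (A ∪ B) (N + N') := by
  obtain ⟨c, hc, hp⟩ := hA
  obtain ⟨c', hc', hp'⟩ := hB
  classical
  refine ⟨fun v => if v ∈ A then c v else N + c' v, ?_, ?_⟩
  · intro v hv
    by_cases h : v ∈ A
    · have := hc v h
      simp only [h, if_true]; omega
    · have hvB : v ∈ B := by simpa [h] using hv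
      have := hc' v hvB
      simp only [h, if_false]; omega
  · intro u hu v hv huv
    by_cases h : u ∈ A <;> by_cases h' : v ∈ A
    · simpa [h, h'] using hp u h v h' huv
    · have := hc u h
      simp only [h, h', if_true, if_false]; omega
    · have := hc v h'
      simp only [h, h', if_true, if_false]; omega
    · have := hp' u (by simpa [h] using hu) v (by simpa [h'] using hv) huv
      simp only [h, h', if_false]; omega

lemma ColorableOn.subset (hA : ColorableOn H A N) (hB : B ⊆ A) : ColorableOn H B N := by
  obtain ⟨c, hc, hp⟩ := hA
  exact ⟨c, fun v hv => hc v (hB hv), fun u hu v hv => hp u (hB hu) v (hB hv)⟩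

/-- Product colouring: every edge of `H` is an edge of one of two coloured graphs. -/
lemma ColorableOn.prod {H₁ H₂ : SimpleGraph V} (h₁ : ColorableOn H₁ A N)
    (h₂ : ColorableOn H₂ A N')
    (hle : ∀ u ∈ A, ∀ v ∈ A, H.Adj u v → H₁.Adj u v ∨ H₂.Adj u v) :
    ColorableOn H A (N * N') := by
  obtain ⟨c, hc, hp⟩ := h₁
  obtain ⟨c', hc', hp'⟩ := h₂
  refine ⟨fun v => c v * N' + c' v, ?_, ?_⟩
  · intro v hv
    have h1 := hc v hv
    have h2 := hc' v hv
    calc c v * N' + c' v < c v * N' + N' := by omega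
      _ = (c v + 1) * N' := by ring
      _ ≤ N * N' := Nat.mul_le_mul_right _ h1
  · intro u hu v hv huv heq
    have h2 := hc' u hu
    have h2' := hc' v hv
    have e1 : c u = c v := by
      have a := congrArg (· / N') heq
      have hN : 0 < N' := by omega
      simpa [Nat.mul_add_div, mul_comm _ N', Nat.mul_add_div hN, Nat.div_eq_of_lt h2,
        Nat.div_eq_of_lt h2'] using a
    have e2 : c' u = c' v := by
      simp only [e1] at heq; omega
    rcases hle u hu v hv huv with h | h
    · exact hp u hu v hv h e1
    · exact hp' u hu v hv h e2

end Basic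

/-! ### Weighted colouring by dyadic weight levels -/

section Weighted

/-- The number of colours reserved for the weight levels `i, i + 1, …, M - 1`. -/
def paletteSize (n k M i : ℕ) : ℕ :=
  ∑ j ∈ Finset.Ico i M, 2 ^ ((j + 1) * k) * (n / 2 ^ j) ^ (2 * k + 3)

lemma paletteSize_eq {n k M i : ℕ} (h : i < M) :
    paletteSize n k M i =
      2 ^ ((i + 1) * k) * (n / 2 ^ i) ^ (2 * k + 3) + paletteSize n k M (i + 1) := by
  rw [paletteSize, Finset.sum_eq_sum_Ico_succ_bot h, paletteSize]

lemma paletteSize_anti {n k M i j : ℕ} (h : i ≤ j) : paletteSize n k M j ≤ paletteSize n k M i :=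
  Finset.sum_le_sum_of_subset (Finset.Ico_subset_Ico_left h)

/-- This is where the exponent comes from: for `i ≥ 1` the part `2 * k` absorbs the `2 ^ ((i + 1) *
k)` colours of a level, and the extra 3 leaves a decay of `8 ^ i`. -/
lemma paletteSize_term_le (n k : ℕ) {i : ℕ} (hi : 1 ≤ i) :
    8 ^ i * (2 ^ ((i + 1) * k) * (n / 2 ^ i) ^ (2 * k + 3)) ≤ n ^ (2 * k + 3) := by
  have h1 : 2 ^ i * (n / 2 ^ i) ≤ n := Nat.mul_div_le n (2 ^ i)
  have h2 : (2 : ℕ) ^ ((i + 1) * k) ≤ 2 ^ (2 * i * k) :=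
    Nat.pow_le_pow_right (by norm_num) (Nat.mul_le_mul_right _ (by omega))
  calc 8 ^ i * (2 ^ ((i + 1) * k) * (n / 2 ^ i) ^ (2 * k + 3))
      ≤ 8 ^ i * (2 ^ (2 * i * k) * (n / 2 ^ i) ^ (2 * k + 3)) := by gcongr
    _ = (2 ^ i * (n / 2 ^ i)) ^ (2 * k + 3) := by
        rw [mul_pow, ← mul_assoc, show (8 : ℕ) = 2 ^ 3 by norm_num, ← pow_mul, ← pow_mul,
          ← pow_add]
        congr 2; ring
    _ ≤ n ^ (2 * k + 3) := Nat.pow_le_pow_left h1 _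

lemma paletteSize_le (n k M : ℕ) {i : ℕ} (hi : 1 ≤ i) :
    7 * 8 ^ i * paletteSize n k M i ≤ 8 * n ^ (2 * k + 3) := by
  induction hm : M - i generalizing i with
  | zero => simp [paletteSize, Finset.Ico_eq_empty_of_le (show M ≤ i by omega)]
  | succ m ih =>
    have h1 := ih (i := i + 1) (by omega) (by omega)
    have h2 := paletteSize_term_le n k hi
    rw [paletteSize_eq (by omega)]
    rw [pow_succ] at h1
    nlinarith

/-- Lowering `n` by `w` frees at least `w * n ^ (2 * k + 2)` colours. The palettes from level `i` on
form a geometric series of ratio 1/8, while `w` exceeds `n / 2 ^ (i + 1)`, so they fit. -/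
lemma paletteSize_add_le {n k M i w : ℕ} (hi : 1 ≤ i) (hw : n < 2 ^ (i + 1) * w) (hwn : w ≤ n) :
    paletteSize n k M i + (n - w) ^ (2 * k + 3) ≤ n ^ (2 * k + 3) := by
  have h1 := paletteSize_le n k M hi
  have h2 : (n - w) ^ (2 * k + 3) + w * n ^ (2 * k + 2) ≤ n ^ (2 * k + 3) := by
    calc (n - w) ^ (2 * k + 3) + w * n ^ (2 * k + 2)
        = (n - w) * (n - w) ^ (2 * k + 2) + w * n ^ (2 * k + 2) := by ring
      _ ≤ (n - w) * n ^ (2 * k + 2) + w * n ^ (2 * k + 2) := by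
          gcongr; omega
      _ = (n - w + w) * n ^ (2 * k + 2) := by ring
      _ = n ^ (2 * k + 3) := by rw [Nat.sub_add_cancel hwn]; ring
  have h3 : paletteSize n k M i ≤ w * n ^ (2 * k + 2) := by
    have h4 : n ^ (2 * k + 3) ≤ 2 ^ (i + 1) * w * n ^ (2 * k + 2) := by
      rw [pow_succ, mul_comm]
      exact Nat.mul_le_mul_right _ hw.le
    have h5 : 8 * 2 ^ (i + 1) ≤ 7 * 8 ^ i := by
      have : (4 : ℕ) ^ 1 ≤ 4 ^ i := Nat.pow_le_pow_right (by norm_num) hi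
      have e : (8 : ℕ) ^ i = 2 ^ i * 4 ^ i := by rw [← mul_pow]; norm_num
      rw [e, pow_succ]
      nlinarith [pow_pos (show 0 < 2 by norm_num) i]
    have h6 : 7 * 8 ^ i * paletteSize n k M i ≤ 7 * 8 ^ i * (w * n ^ (2 * k + 2)) :=
      calc _ ≤ 8 * n ^ (2 * k + 3) := h1
        _ ≤ 8 * (2 ^ (i + 1) * w * n ^ (2 * k + 2)) := by gcongr
        _ = 8 * 2 ^ (i + 1) * (w * n ^ (2 * k + 2)) := by ring
        _ ≤ _ := Nat.mul_le_mul_right _ h5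
    exact Nat.le_of_mul_le_mul_left h6 (by positivity)
  omega

/-- In a graph with polynomial hereditary colourings, a weighting whose cliques have weight at
most `n` can be multicoloured with `n ^ (2 * k + 3)` colours. -/
theorem exists_multicoloring {V : Type*} [DecidableEq V] (H : SimpleGraph V) (A : Finset V)
    (w : V → ℕ) (hw : ∀ v ∈ A, 1 ≤ w v) (n k : ℕ)
    (hcl : ∀ K ⊆ A, H.IsClique (K : Set V) → ∑ v ∈ K, w v ≤ n)
    (hk : ∀ B ⊆ A, ∀ m, CliqueBound H B m → ColorableOn H B (m ^ k)) :
    ∃ S : V → Finset ℕ,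
      (∀ v ∈ A, S v ⊆ Finset.range (n ^ (2 * k + 3)) ∧ w v ^ (2 * k + 3) ≤ (S v).card) ∧
      ∀ u ∈ A, ∀ v ∈ A, H.Adj u v → Disjoint (S u) (S v) := by
  have hwn : ∀ v ∈ A, w v ≤ n := fun v hv => by
    simpa using hcl {v} (by simpa using hv) (by simp)
  have hadj : ∀ u ∈ A, ∀ v ∈ A, H.Adj u v → w u + w v ≤ n := fun u hu v hv huv => by
    have := hcl {u, v} (by intro x hx; simp at hx; rcases hx with rfl | rfl <;> assumption)
      (by simp [SimpleGraph.isClique_insert, huv])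
    rwa [Finset.sum_pair huv.ne] at this
  -- Level `i` holds the weights in `(n / 2 ^ (i + 1), n / 2 ^ i]`, so its cliques have fewer than
  -- `2 ^ (i + 1)` vertices.
  set lev : V → ℕ := fun v => Nat.log 2 (n / w v) with hlev
  have hlow : ∀ v ∈ A, 2 ^ lev v * w v ≤ n := fun v hv => by
    have h0 : n / w v ≠ 0 := (Nat.div_pos (hwn v hv) (hw v hv)).ne'
    exact (Nat.le_div_iff_mul_le (hw v hv)).1 (Nat.pow_log_le_self 2 h0)
  have hhigh : ∀ v ∈ A, n < 2 ^ (lev v + 1) * w v := fun v hv =>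
    (Nat.div_lt_iff_lt_mul (hw v hv)).1 (Nat.lt_pow_succ_log_self (by norm_num) _)
  have hcb : ∀ i, CliqueBound H (A.filter fun v => lev v = i) (2 ^ (i + 1)) := by
    intro i K hK hc
    rcases K.eq_empty_or_nonempty with rfl | hne
    · simp
    have hs := hcl K (hK.trans (Finset.filter_subset _ _)) hc
    have h1 : ∑ v ∈ K, n < ∑ v ∈ K, 2 ^ (i + 1) * w v := by
      refine Finset.sum_lt_sum_of_nonempty hne fun v hv => ?_
      have := Finset.mem_filter.1 (hK hv)
      simpa [this.2] using hhigh v this.1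
    rw [Finset.sum_const, smul_eq_mul, ← Finset.mul_sum] at h1
    have h2 : K.card * n < 2 ^ (i + 1) * n := h1.trans_le (Nat.mul_le_mul_left _ hs)
    exact (Nat.lt_of_mul_lt_mul_right h2).le
  choose c hc hp using fun i => hk _ (Finset.filter_subset (fun v => lev v = i) A) _ (hcb i)
  set M := n + 1 with hM
  have hlevM : ∀ v ∈ A, lev v < M := fun v hv => by
    have h1 : lev v ≤ n / w v := Nat.log_le_self _ _
    have h2 : n / w v ≤ n := Nat.div_le_self _ _
    omega
  set s : ℕ → ℕ := fun i => (n / 2 ^ i) ^ (2 * k + 3) with hs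
  -- Light levels are stacked from the bottom, the lightest lowest, and each colour of a level
  -- becomes a block of length `s i`. Level 0 takes final segments of the whole range; these may
  -- overlap, since two vertices heavier than `n / 2` are never adjacent.
  set S : V → Finset ℕ := fun v =>
    if lev v = 0 then Finset.Ico (n ^ (2 * k + 3) - w v ^ (2 * k + 3)) (n ^ (2 * k + 3))
    else Finset.Ico (paletteSize n k M (lev v + 1) + c (lev v) v * s (lev v))
      (paletteSize n k M (lev v + 1) + (c (lev v) v + 1) * s (lev v)) with hS
  have hlight : ∀ v ∈ A, lev v ≠ 0 → ∀ x ∈ S v, paletteSize n k M (lev v + 1) ≤ x ∧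
      x < paletteSize n k M (lev v) := by
    intro v hv h0 x hx
    simp only [hS, h0, if_false, Finset.mem_Ico] at hx
    refine ⟨by omega, ?_⟩
    have h1 : c (lev v) v + 1 ≤ 2 ^ ((lev v + 1) * k) := by
      rw [pow_mul]; exact hc (lev v) v (by simp [hv])
    rw [paletteSize_eq (hlevM v hv)]
    have := Nat.mul_le_mul_right (s (lev v)) h1
    simp only [hs] at this hx ⊢
    omega
  have hbound : ∀ v ∈ A, lev v ≠ 0 →
      paletteSize n k M (lev v) + (n - w v) ^ (2 * k + 3) ≤ n ^ (2 * k + 3) :=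
    fun v hv h0 => paletteSize_add_le (by omega) (hhigh v hv) (hwn v hv)
  -- Adjacency gives `w u ≤ n - w v`, so the final segment of `u` starts above the palette of the
  -- level of `v`.
  have hmixed : ∀ u ∈ A, ∀ v ∈ A, H.Adj u v → lev u = 0 → lev v ≠ 0 → Disjoint (S u) (S v) := by
    intro u hu v hv huv hu0 hv0
    rw [Finset.disjoint_left]
    intro x hx hx'
    have h1 := (hlight v hv hv0 x hx').2
    have h2 := hbound v hv hv0
    simp only [hS, hu0, if_true, Finset.mem_Ico] at hx
    have h3 : w u ^ (2 * k + 3) ≤ (n - w v) ^ (2 * k + 3) :=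
      Nat.pow_le_pow_left (by have := hadj u hu v hv huv; omega) _
    omega
  refine ⟨S, ?_, ?_⟩
  · intro v hv
    by_cases h0 : lev v = 0
    · have := Nat.pow_le_pow_left (hwn v hv) (2 * k + 3)
      simp only [hS, h0, if_true, Nat.card_Ico]
      refine ⟨fun x hx => ?_, by omega⟩
      simp only [Finset.mem_Ico] at hx
      simpa using hx.2
    · refine ⟨fun x hx => ?_, ?_⟩
      · have h1 := (hlight v hv h0 x hx).2
        have h2 := hbound v hv h0
        rw [Finset.mem_range]; omega
      · simp only [hS, h0, if_false, Nat.card_Ico]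
        have : w v ^ (2 * k + 3) ≤ s (lev v) := by
          refine Nat.pow_le_pow_left ?_ _
          rw [Nat.le_div_iff_mul_le (by positivity), mul_comm]
          exact hlow v hv
        rw [add_mul, one_mul]; omega
  · intro u hu v hv huv
    by_cases hu0 : lev u = 0 <;> by_cases hv0 : lev v = 0
    · have h1 := hhigh u hu
      have h2 := hhigh v hv
      have h3 := hadj u hu v hv huv
      rw [hu0] at h1
      rw [hv0] at h2
      omega
    · exact hmixed u hu v hv huv hu0 hv0
    · exact (hmixed v hv u hu huv.symm hv0 hu0).symm
    · rw [Finset.disjoint_left]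
      intro x hx hx'
      have h1 := hlight u hu hu0 x hx
      have h2 := hlight v hv hv0 x hx'
      rcases lt_trichotomy (lev u) (lev v) with h | h | h
      · have := paletteSize_anti (n := n) (k := k) (M := M) (show lev u + 1 ≤ lev v from h)
        omega
      · simp only [hS, hu0, hv0, if_false, Finset.mem_Ico] at hx hx'
        rw [← h] at hx'
        have hne := hp (lev u) u (by simp [hu]) v (by simp [hv, h]) huv
        rcases Nat.lt_or_gt_of_ne hne with h' | h'
        · have := Nat.mul_le_mul_right (s (lev u)) (show c (lev u) u + 1 ≤ c (lev u) v from h')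
          omega
        · have := Nat.mul_le_mul_right (s (lev u)) (show c (lev u) v + 1 ≤ c (lev u) u from h')
          omega
      · have := paletteSize_anti (n := n) (k := k) (M := M) (show lev v + 1 ≤ lev u from h)
        omega

end Weighted

/-! ### Iterated substitution -/

section Substitution

variable {V : Type*}

lemma exists_enumeration {S : Finset ℕ} {M : ℕ} (h : M ≤ S.card) :
    ∃ e : ℕ → ℕ, (∀ i < M, e i ∈ S) ∧ ∀ i < M, ∀ j < M, e i = e j → i = j := by
  refine ⟨fun i => if hi : i < S.card then S.orderEmbOfFin rfl ⟨i, hi⟩ else 0, ?_, ?_⟩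
  · intro i hi
    simp only [hi.trans_le h, dif_pos]
    exact Finset.orderEmbOfFin_mem _ _ _
  · intro i hi j hj hij
    simp only [hi.trans_le h, hj.trans_le h, dif_pos] at hij
    simpa using (S.orderEmbOfFin rfl).injective hij

open Classical in
lemma exists_max_clique (H : SimpleGraph V) (Z : Finset V) :
    ∃ w, CliqueBound H Z w ∧ ∃ K ⊆ Z, H.IsClique (K : Set V) ∧ K.card = w := by
  obtain ⟨K, hK, hmax⟩ := Finset.exists_max_image
    (Z.powerset.filter fun K : Finset V => H.IsClique (K : Set V)) Finset.card ⟨∅, by simp⟩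
  simp only [Finset.mem_filter, Finset.mem_powerset] at hK hmax
  exact ⟨K.card, fun K' h h' => hmax K' ⟨h, h'⟩, K, hK.1, hK.2, rfl⟩

open Classical in
/-- Iterated substitution: if a graph is built by a chain of module partitions whose quotients
are hereditarily `m ^ k`-colourable, then it is `n ^ (2 * k + 3)`-colourable. -/
theorem colorableOn_of_iterated_substitution (H : SimpleGraph V) (U : Finset V)
    (E : ℕ → V → V → Prop) (hE : ∀ j, Equivalence (E j)) (h0 : ∀ x ∈ U, ∀ y ∈ U, E 0 x y)
    (N : ℕ) (hN : ∀ x ∈ U, ∀ y ∈ U, E N x y → x = y)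
    (hmod : ∀ j, ∀ x ∈ U, ∀ x' ∈ U, ∀ y ∈ U, E j x y → ¬ E (j + 1) x y → E (j + 1) x x' →
      H.Adj x y → H.Adj x' y)
    (k : ℕ)
    (hq : ∀ j, ∀ A ⊆ U, (∀ x ∈ A, ∀ y ∈ A, E j x y) →
      (∀ x ∈ A, ∀ y ∈ A, E (j + 1) x y → x = y) →
      ∀ m, CliqueBound H A m → ColorableOn H A (m ^ k))
    (n : ℕ) (hn : CliqueBound H U n) : ColorableOn H U (n ^ (2 * k + 3)) := by
  suffices key : ∀ f j, f + j = N → ∀ Y ⊆ U, (∀ x ∈ Y, ∀ y ∈ Y, E j x y) → ∀ n,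
      CliqueBound H Y n → ColorableOn H Y (n ^ (2 * k + 3)) from
    key N 0 (by omega) U (Finset.Subset.refl _) h0 n hn
  intro f
  induction f with
  | zero =>
    intro j hj Y hY hYE n hn
    obtain rfl : j = N := by omega
    exact hn.colorableOn_of_no_adj _ fun u hu v hv huv =>
      huv.ne (hN u (hY hu) v (hY hv) (hYE u hu v hv))
  | succ f ih =>
    intro j hj Y hY hYE n hn
    set Z : V → Finset V := fun x => Y.filter fun y => E (j + 1) x y with hZ
    have hZeq : ∀ x y, E (j + 1) x y → Z x = Z y := fun x y hxy => by
      ext z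
      simp only [hZ, Finset.mem_filter]
      exact and_congr_right fun _ =>
        ⟨fun h => (hE _).trans ((hE _).symm hxy) h, fun h => (hE _).trans hxy h⟩
    have hZY : ∀ x, Z x ⊆ Y := fun x => Finset.filter_subset _ _
    have hself : ∀ x ∈ Y, x ∈ Z x := fun x hx => by simp [hZ, hx, (hE _).refl]
    -- For nonempty `s` the choice depends on `s` only, so equivalent vertices get the same
    -- representative; `x` is a default value.
    set f : Finset V → V → V := fun s x => if h : s.Nonempty then h.choose else x with hf
    set rep : V → V := fun x => f (Z x) x with hrep
    have hrepZ : ∀ x ∈ Y, rep x ∈ Z x := fun x hx => by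
      have h : (Z x).Nonempty := ⟨x, hself x hx⟩
      simp only [hrep, hf, h, dif_pos]
      exact h.choose_spec
    have hrepY : ∀ x ∈ Y, rep x ∈ Y := fun x hx => hZY x (hrepZ x hx)
    have hrepE : ∀ x ∈ Y, E (j + 1) x (rep x) := fun x hx =>
      (Finset.mem_filter.1 (hrepZ x hx)).2
    have hrepeq : ∀ x ∈ Y, ∀ y ∈ Y, E (j + 1) x y → rep x = rep y := fun x hx y hy hxy => by
      have h : (Z y).Nonempty := ⟨y, hself y hy⟩
      simp only [hrep, hf, hZeq x y hxy, h, dif_pos]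
    set A := Y.image rep with hA
    have hAY : A ⊆ Y := fun a ha => by
      obtain ⟨x, hx, rfl⟩ := Finset.mem_image.1 ha
      exact hrepY x hx
    have hAsep : ∀ x ∈ A, ∀ y ∈ A, E (j + 1) x y → x = y := by
      intro a ha b hb hab
      obtain ⟨x, hx, rfl⟩ := Finset.mem_image.1 ha
      obtain ⟨y, hy, rfl⟩ := Finset.mem_image.1 hb
      exact hrepeq x hx y hy ((hE _).trans (hrepE x hx) ((hE _).trans hab ((hE _).symm (hrepE y hy))))
    choose w hwb K hKZ hKc hKw using fun a => exists_max_clique H (Z a)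
    have hmod2 : ∀ x ∈ Y, ∀ y ∈ Y, ∀ x' ∈ Y, ∀ y' ∈ Y, ¬ E (j + 1) x y → E (j + 1) x x' →
        E (j + 1) y y' → H.Adj x y → H.Adj x' y' := by
      intro x hx y hy x' hx' y' hy' hxy hxx hyy hadj
      have h1 := hmod j x (hY hx) x' (hY hx') y (hY hy) (hYE x hx y hy) hxy hxx hadj
      refine (hmod j y (hY hy) y' (hY hy') x' (hY hx') (hYE y hy x' hx') ?_ hyy h1.symm).symm
      exact fun h => hxy ((hE _).trans hxx ((hE _).symm h))
    -- Replacing each vertex of a clique of the transversal `A` by a maximum clique of its module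
    -- gives a clique of `H`, so the weights on it add up to at most `n`.
    obtain ⟨S, hS, hSd⟩ := exists_multicoloring H A w
      (fun a ha => by
        have := hwb a {a} (by simpa using hself a (hAY ha)) (by simp)
        simpa using this) n k
      (fun Q hQ hc => by
        have hdisj : ∀ a ∈ Q, ∀ b ∈ Q, a ≠ b → Disjoint (K a) (K b) := by
          intro a ha b hb hab
          rw [Finset.disjoint_left]
          intro x hx hx'
          have h1 := (Finset.mem_filter.1 (hKZ a hx)).2
          have h2 := (Finset.mem_filter.1 (hKZ b hx')).2
          exact hab (hAsep a (hQ ha) b (hQ hb) ((hE _).trans h1 ((hE _).symm h2)))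
        have hcard : (Q.biUnion K).card = ∑ a ∈ Q, w a := by
          rw [Finset.card_biUnion hdisj]
          exact Finset.sum_congr rfl fun a _ => hKw a
        rw [← hcard]
        refine hn _ (fun x hx => ?_) ?_
        · obtain ⟨a, ha, hxa⟩ := Finset.mem_biUnion.1 hx
          exact hZY a (hKZ a hxa)
        · intro x hx y hy hxy
          obtain ⟨a, ha, hxa⟩ := Finset.mem_biUnion.1 (Finset.mem_coe.1 hx)
          obtain ⟨b, hb, hyb⟩ := Finset.mem_biUnion.1 (Finset.mem_coe.1 hy)
          by_cases hab : a = b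
          · subst hab
            exact hKc a hxa hyb hxy
          · have h1 := Finset.mem_filter.1 (hKZ a hxa)
            have h2 := Finset.mem_filter.1 (hKZ b hyb)
            exact hmod2 a (hAY (hQ ha)) b (hAY (hQ hb)) x h1.1 y h2.1
              (fun h => hab (hAsep a (hQ ha) b (hQ hb) h)) h1.2 h2.2 (hc ha hb hab))
      (fun B hB m hm => hq j B (hB.trans (hAY.trans hY))
        (fun x hx y hy => hYE x (hAY (hB hx)) y (hAY (hB hy)))
        (fun x hx y hy => hAsep x (hB hx) y (hB hy)) m hm)
    have hcol : ∀ a, ColorableOn H (Z a) (w a ^ (2 * k + 3)) := fun a =>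
      ih (j + 1) (by omega) (Z a) ((hZY a).trans hY)
        (fun x hx y hy => (hE _).trans ((hE _).symm (Finset.mem_filter.1 hx).2)
          (Finset.mem_filter.1 hy).2) _ (hwb a)
    choose c hc hp using hcol
    have hex : ∀ a, ∃ e : ℕ → ℕ, a ∈ A → (∀ i < w a ^ (2 * k + 3), e i ∈ S a) ∧
        ∀ i < w a ^ (2 * k + 3), ∀ i' < w a ^ (2 * k + 3), e i = e i' → i = i' := by
      intro a
      by_cases ha : a ∈ A
      · obtain ⟨e, he⟩ := exists_enumeration (hS a ha).2
        exact ⟨e, fun _ => he⟩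
      · exact ⟨id, fun h => (ha h).elim⟩
    choose e he using hex
    have hrepA : ∀ x ∈ Y, rep x ∈ A := fun x hx => Finset.mem_image_of_mem _ hx
    have hxrep : ∀ x ∈ Y, x ∈ Z (rep x) := fun x hx => by
      simp [hZ, hx, (hE _).symm (hrepE x hx)]
    -- The recursive colouring of each module is injected into the colour set of its representative.
    refine ⟨fun v => e (rep v) (c (rep v) v), ?_, ?_⟩
    · intro v hv
      have := (he _ (hrepA v hv)).1 _ (hc (rep v) v (hxrep v hv))
      simpa using (hS _ (hrepA v hv)).1 this
    · intro u hu v hv huv heq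
      simp only at heq
      by_cases h : rep u = rep v
      · rw [h] at heq
        have hu' : u ∈ Z (rep v) := h ▸ hxrep u hu
        have := (he _ (hrepA v hv)).2 _ (hc _ u hu') _ (hc _ v (hxrep v hv)) heq
        exact hp (rep v) u hu' v (hxrep v hv) huv this
      · have hne : ¬ E (j + 1) u v := fun h' => h (hrepeq u hu v hv h')
        have hadj := hmod2 u hu v hv _ (hrepY u hu) _ (hrepY v hv) hne (hrepE u hu) (hrepE v hv) huv
        have h1 := (he _ (hrepA u hu)).1 _ (hc (rep u) u (hxrep u hu))
        have h2 := (he _ (hrepA v hv)).1 _ (hc (rep v) v (hxrep v hv))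
        rw [← heq] at h2
        exact Finset.disjoint_left.1 (hSd _ (hrepA u hu) _ (hrepA v hv) hadj) h1 h2

end Substitution

/-! ### The delayed decomposition -/

section Delayed

variable {V : Type*} [LinearOrder V]

/-- The edges `uv` of `H` such that some vertex of `L` distinguishes two vertices of `Y` that lie
between `u` and `v`. -/
def acrossGraph (H : SimpleGraph V) (L Y : Finset V) : SimpleGraph V where
  Adj u v := H.Adj u v ∧ ∃ z ∈ Y, ∃ z' ∈ Y, z ∈ Set.uIcc u v ∧ z' ∈ Set.uIcc u v ∧
    ∃ l ∈ L, H.Adj l z ∧ ¬ H.Adj l z'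
  symm := ⟨fun u v h => by rw [Set.uIcc_comm]; exact ⟨h.1.symm, h.2⟩⟩
  loopless := ⟨fun u h => h.1.ne rfl⟩

/-- The delayed decomposition of `H` on `U`: a class at depth `i + 1` is split into its minimum and
the maximal intervals of vertices with the same neighbours in the rest of the class at depth `i`. -/
def DelayedRel (H : SimpleGraph V) (U : Finset V) : ℕ → V → V → Prop
  | 0 => fun _ _ => True
  | 1 => fun _ _ => True
  | i + 2 => fun u v => u = v ∨ (u ∈ U ∧ v ∈ U ∧ DelayedRel H U (i + 1) u v ∧
      (∃ a ∈ U, DelayedRel H U (i + 1) u a ∧ a < u) ∧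
      (∃ a ∈ U, DelayedRel H U (i + 1) u a ∧ a < v) ∧
      ∀ z ∈ U, z ∈ Set.uIcc u v → ∀ l ∈ U, DelayedRel H U i u l → ¬ DelayedRel H U (i + 1) u l →
        (H.Adj l z ↔ H.Adj l u))

variable {H : SimpleGraph V} {U : Finset V}

/-- Two consecutive depths are carried together because each depth is defined from the previous two.
-/
lemma delayedRel_equivalence_pair (i : ℕ) :
    Equivalence (DelayedRel H U i) ∧ Equivalence (DelayedRel H U (i + 1)) := by
  induction i with
  | zero => exact ⟨⟨fun _ => trivial, fun _ => trivial, fun _ _ => trivial⟩,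
      ⟨fun _ => trivial, fun _ => trivial, fun _ _ => trivial⟩⟩
  | succ i ih =>
    obtain ⟨h0, h1⟩ := ih
    refine ⟨h1, ⟨fun _ => Or.inl rfl, ?_, ?_⟩⟩
    · rintro u v (rfl | ⟨hu, hv, huv, ⟨a, ha, hua, hau⟩, ⟨b, hb, hub, hbv⟩, hz⟩)
      · exact Or.inl rfl
      · refine Or.inr ⟨hv, hu, h1.symm huv, ⟨b, hb, h1.trans (h1.symm huv) hub, hbv⟩,
          ⟨a, ha, h1.trans (h1.symm huv) hua, hau⟩, ?_⟩
        intro z hzU hzI l hl hvl hvl'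
        by_cases hul' : DelayedRel H U (i + 1) u l
        · exact (hvl' (h1.trans (h1.symm huv) hul')).elim
        have hul : DelayedRel H U i u l := by
          refine h0.trans ?_ hvl
          cases i with
          | zero => trivial
          | succ i =>
            rcases huv with rfl | h
            · exact h0.refl _
            · exact h.2.2.1
        rw [hz z hzU (by rwa [Set.uIcc_comm]) l hl hul hul',
          hz v hv Set.right_mem_uIcc l hl hul hul']
    · rintro u v w (rfl | ⟨hu, hv, huv, ⟨a, ha, hua, hau⟩, ⟨b, hb, hub, hbv⟩, hz⟩)
        (rfl | ⟨hv', hw, hvw, ⟨c, hc, hvc, hcv⟩, ⟨d, hd, hvd, hdw⟩, hz'⟩)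
      · exact Or.inl rfl
      · exact Or.inr ⟨hv', hw, hvw, ⟨c, hc, hvc, hcv⟩, ⟨d, hd, hvd, hdw⟩, hz'⟩
      · exact Or.inr ⟨hu, hv, huv, ⟨a, ha, hua, hau⟩, ⟨b, hb, hub, hbv⟩, hz⟩
      · refine Or.inr ⟨hu, hw, h1.trans huv hvw, ⟨a, ha, hua, hau⟩,
          ⟨d, hd, h1.trans huv hvd, hdw⟩, ?_⟩
        intro z hzU hzI l hl hul hul'
        have hvl' : ¬ DelayedRel H U (i + 1) v l := fun h => hul' (h1.trans huv h)
        have hvl : DelayedRel H U i v l := by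
          refine h0.trans ?_ hul
          cases i with
          | zero => trivial
          | succ i =>
            rcases h1.symm huv with rfl | h
            · exact h0.refl _
            · exact h.2.2.1
        rcases Set.uIcc_subset_uIcc_union_uIcc (b := v) hzI with h | h
        · exact hz z hzU h l hl hul hul'
        · rw [hz' z hzU h l hl hvl hvl', hz v hv Set.right_mem_uIcc l hl hul hul']

lemma delayedRel_equivalence (i : ℕ) : Equivalence (DelayedRel H U i) :=
  (delayedRel_equivalence_pair i).1

lemma DelayedRel.of_succ {i : ℕ} {u v : V} (h : DelayedRel H U (i + 1) u v) :
    DelayedRel H U i u v := by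
  cases i with
  | zero => trivial
  | succ i =>
    rcases h with rfl | h
    · exact (delayedRel_equivalence _).refl _
    · exact h.2.2.1

lemma DelayedRel.anti {i j : ℕ} (hij : i ≤ j) {u v : V} (h : DelayedRel H U j u v) :
    DelayedRel H U i u v := by
  induction hij with
  | refl => exact h
  | step _ ih => exact ih h.of_succ

lemma DelayedRel.convex {i : ℕ} {u v z : V} (h : DelayedRel H U i u v) (hz : z ∈ U)
    (hzI : z ∈ Set.uIcc u v) : DelayedRel H U i u z := by
  induction i with
  | zero => trivial
  | succ i ih =>
    cases i with
    | zero => trivial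
    | succ i =>
      rcases h with rfl | ⟨hu, hv, huv, ⟨a, ha, hua, hau⟩, ⟨b, hb, hub, hbv⟩, hz'⟩
      · simp at hzI
        exact Or.inl hzI.symm
      · refine Or.inr ⟨hu, hz, ih huv, ⟨a, ha, hua, hau⟩, ?_, ?_⟩
        · rcases le_total u v with h | h
          · rw [Set.uIcc_of_le h] at hzI
            exact ⟨a, ha, hua, hau.trans_le hzI.1⟩
          · rw [Set.uIcc_of_ge h] at hzI
            exact ⟨b, hb, hub, hbv.trans_le hzI.1⟩
        · intro y hy hyI
          exact hz' y hy (Set.uIcc_subset_uIcc_left hzI hyI)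

open Classical in
-- The minimum of a class becomes a singleton at the next depth, so a class that still has two
-- vertices has lost at least one. This is the reason for splitting off minima.
lemma delayedRel_card (i : ℕ) {u : V} (hu : u ∈ U) :
    (U.filter fun v => DelayedRel H U (i + 1) u v).card + i ≤ U.card ∨
      (U.filter fun v => DelayedRel H U (i + 1) u v).card ≤ 1 := by
  induction i with
  | zero => exact Or.inl (Finset.card_filter_le _ _)
  | succ i ih =>
    by_cases h1 : (U.filter fun v => DelayedRel H U (i + 1 + 1) u v).card ≤ 1
    · exact Or.inr h1
    left
    have hE := delayedRel_equivalence (H := H) (U := U)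
    have hsub : (U.filter fun v => DelayedRel H U (i + 1 + 1) u v) ⊆
        U.filter fun v => DelayedRel H U (i + 1) u v := fun v hv => by
      simp only [Finset.mem_filter] at hv ⊢
      exact ⟨hv.1, hv.2.of_succ⟩
    have hne : (U.filter fun v => DelayedRel H U (i + 1) u v).Nonempty :=
      ⟨u, by simp [hu, (hE _).refl]⟩
    set μ := (U.filter fun v => DelayedRel H U (i + 1) u v).min' hne with hμ
    have hμmem := Finset.min'_mem _ hne
    have hμmin : ∀ a ∈ U, DelayedRel H U (i + 1) u a → ¬ a < μ := fun a ha hua =>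
      not_lt.2 (Finset.min'_le _ _ (by simp [ha, hua]))
    have hlt : (U.filter fun v => DelayedRel H U (i + 1 + 1) u v).card <
        (U.filter fun v => DelayedRel H U (i + 1) u v).card := by
      refine Finset.card_lt_card (Finset.ssubset_iff_of_subset hsub |>.2 ⟨μ, hμmem, ?_⟩)
      intro hmem
      obtain ⟨v, hv, hvμ⟩ := Finset.exists_mem_ne (not_le.1 h1) μ
      have h2 := (Finset.mem_filter.1 hmem).2
      have h3 := (Finset.mem_filter.1 hv).2
      rcases (hE _).trans ((hE _).symm h2) h3 with h | ⟨_, _, _, ⟨a, ha, hua, haμ⟩, _⟩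
      · exact hvμ h.symm
      · exact hμmin a ha ((hE _).trans h2.of_succ hua) haμ
    omega

lemma DelayedRel.eq {i : ℕ} (hi : U.card + 1 ≤ i) {u v : V} (hu : u ∈ U) (hv : v ∈ U)
    (h : DelayedRel H U i u v) : u = v := by
  classical
  have h := h.anti hi
  have hE := delayedRel_equivalence (H := H) (U := U)
  have hu' : u ∈ U.filter fun v => DelayedRel H U (U.card + 1) u v := by
    simp [hu, (hE _).refl]
  have hpos := Finset.card_pos.2 ⟨u, hu'⟩
  have hone : (U.filter fun v => DelayedRel H U (U.card + 1) u v).card ≤ 1 := by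
    rcases delayedRel_card (H := H) U.card hu with h' | h' <;> omega
  exact Finset.card_le_one.1 hone u hu' v (by simp [hv, h])

/-- The edges of `H` that are separated by the delayed decomposition at a depth `≡ p` mod 2. -/
def parityGraph (H : SimpleGraph V) (U : Finset V) (p : ℕ) : SimpleGraph V where
  Adj x y := H.Adj x y ∧ ∃ j, DelayedRel H U (2 * j + p) x y ∧ ¬ DelayedRel H U (2 * j + p + 1) x y
  symm := ⟨fun _ _ h => ⟨h.1.symm, h.2.imp fun _ hj =>
    ⟨(delayedRel_equivalence _).symm hj.1, fun h => hj.2 ((delayedRel_equivalence _).symm h)⟩⟩⟩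
  loopless := ⟨fun _ h => h.1.ne rfl⟩

/-- Depths refine each other, so the only separation of parity `p` available to such a pair is the
one right after depth `2 * j + p`. -/
lemma parityGraph_adj_iff {p j : ℕ} {x y : V} (h : DelayedRel H U (2 * j + p) x y)
    (h' : ¬ DelayedRel H U (2 * (j + 1) + p) x y) :
    (parityGraph H U p).Adj x y ↔ H.Adj x y ∧ ¬ DelayedRel H U (2 * j + p + 1) x y := by
  refine ⟨?_, fun ⟨h1, h2⟩ => ⟨h1, j, h, h2⟩⟩
  rintro ⟨hadj, j', h1, h2⟩
  refine ⟨hadj, ?_⟩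
  rcases lt_trichotomy j' j with hj | rfl | hj
  · exact (h2 (h.anti (by omega))).elim
  · exact h2
  · exact (h' (h1.anti (by omega))).elim

/-- The quotients of the delayed decomposition. -/
lemma colorableOn_delayed_quotient (k : ℕ)
    (h : ∀ L Y A : Finset V, L ⊆ U → Y ⊆ U → A ⊆ Y →
      ((∀ l ∈ L, ∀ y ∈ Y, l < y) ∨ (∀ l ∈ L, ∀ y ∈ Y, y < l)) →
      ∀ m, CliqueBound (acrossGraph H L Y) A m → ColorableOn (acrossGraph H L Y) A (m ^ k))
    (p j : ℕ) (A : Finset V) (hAU : A ⊆ U)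
    (hA : ∀ x ∈ A, ∀ y ∈ A, DelayedRel H U (2 * j + p) x y)
    (hA' : ∀ x ∈ A, ∀ y ∈ A, DelayedRel H U (2 * (j + 1) + p) x y → x = y)
    (m : ℕ) (hm : CliqueBound (parityGraph H U p) A m) :
    ColorableOn (parityGraph H U p) A (m ^ (2 * k + 1)) := by
  classical
  by_cases hno : ∀ u ∈ A, ∀ v ∈ A, ¬ (parityGraph H U p).Adj u v
  · exact hm.colorableOn_of_no_adj _ hno
  push Not at hno
  obtain ⟨a₀, ha₀, b₀, hb₀, hab₀⟩ := hno
  have hm2 : 2 ≤ m := hm.two_le ha₀ hb₀ hab₀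
  have hadj : ∀ x ∈ A, ∀ y ∈ A, (parityGraph H U p).Adj x y ↔
      H.Adj x y ∧ ¬ DelayedRel H U (2 * j + p + 1) x y := by
    intro x hx y hy
    by_cases hxy : x = y
    · subst hxy
      simp
    · exact parityGraph_adj_iff (hA x hx y hy) fun h => hxy (hA' x hx y hy h)
  have hE := delayedRel_equivalence (H := H) (U := U)
  -- Depths 0 and 1 coincide, so no edge is separated at depth 0 and a parent depth `i` exists.
  obtain ⟨i, hi⟩ : ∃ i, 2 * j + p = i + 1 := by
    rcases Nat.eq_zero_or_pos (2 * j + p) with h0 | h0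
    · have := ((hadj a₀ ha₀ b₀ hb₀).1 hab₀).2
      rw [h0] at this
      exact (this trivial).elim
    · exact ⟨2 * j + p - 1, by omega⟩
  rw [hi] at hA hadj
  set Y := U.filter fun y => DelayedRel H U (i + 1) a₀ y with hY
  set L := U.filter fun l => DelayedRel H U i a₀ l ∧ ∀ y ∈ Y, l < y with hL
  set R := U.filter fun l => DelayedRel H U i a₀ l ∧ ∀ y ∈ Y, y < l with hR
  have hAY : A ⊆ Y := fun x hx => by simp [hY, hAU hx, hA a₀ ha₀ x hx]
  have hYrel : ∀ x ∈ Y, ∀ y ∈ Y, DelayedRel H U (i + 1) x y := fun x hx y hy =>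
    (hE _).trans ((hE _).symm (Finset.mem_filter.1 hx).2) (Finset.mem_filter.1 hy).2
  have hle : ∀ Q : Finset V, Q ⊆ U → (∀ l ∈ Q, DelayedRel H U i a₀ l ∧ l ∉ Y) →
      ∀ u ∈ A, ∀ v ∈ A, (acrossGraph H Q Y).Adj u v → (parityGraph H U p).Adj u v := by
    intro Q hQU hQ u hu v hv huv
    refine (hadj u hu v hv).2 ⟨huv.1, ?_⟩
    rintro (rfl | ⟨-, -, -, -, -, htr⟩)
    · exact huv.1.ne rfl
    · obtain ⟨-, z, hz, z', hz', hzI, hzI', l, hl, hlz, hlz'⟩ := huv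
      have h1 : DelayedRel H U i u l := (hE _).trans (hA u hu a₀ ha₀).of_succ (hQ l hl).1
      have h2 : ¬ DelayedRel H U (i + 1) u l := fun h2 => (hQ l hl).2 (by
        simp only [hY, Finset.mem_filter]
        exact ⟨hQU hl, (hE _).trans (hA a₀ ha₀ u hu) h2⟩)
      have e1 := htr z (Finset.mem_filter.1 hz).1 hzI l (hQU hl) h1 h2
      have e2 := htr z' (Finset.mem_filter.1 hz').1 hzI' l (hQU hl) h1 h2
      exact hlz' (e2.2 (e1.1 hlz))
  have hLU : L ⊆ U := Finset.filter_subset _ _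
  have hRU : R ⊆ U := Finset.filter_subset _ _
  have hYU : Y ⊆ U := Finset.filter_subset _ _
  have hcL := h L Y A hLU hYU hAY (Or.inl fun l hl => (Finset.mem_filter.1 hl).2.2) m
    (hm.mono_graph (hle L hLU fun l hl => by
      have := (Finset.mem_filter.1 hl).2
      exact ⟨this.1, fun h => (this.2 l h).ne rfl⟩))
  have hcR := h R Y A hRU hYU hAY (Or.inr fun l hl => (Finset.mem_filter.1 hl).2.2) m
    (hm.mono_graph (hle R hRU fun l hl => by
      have := (Finset.mem_filter.1 hl).2
      exact ⟨this.1, fun h => (this.2 l h).ne rfl⟩))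
  -- An edge at the minimum of the class may have no distinguishing vertex outside; the minimum gets
  -- a colour of its own.
  set A₁ := A.filter fun x => ∀ a ∈ U, DelayedRel H U (i + 1) x a → x ≤ a with hA₁
  have hc₁ : ColorableOn (parityGraph H U p) A₁ 1 := by
    refine colorableOn_one fun u hu v hv huv => huv.ne ?_
    simp only [hA₁, Finset.mem_filter] at hu hv
    exact le_antisymm (hu.2 v (hAU hv.1) (hA u hu.1 v hv.1))
      (hv.2 u (hAU hu.1) (hA v hv.1 u hu.1))
  have hc₂ : ColorableOn (parityGraph H U p) (A \ A₁) (m ^ k * m ^ k) := by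
    refine (hcL.subset Finset.sdiff_subset).prod (hcR.subset Finset.sdiff_subset) ?_
    intro u hu v hv huv
    simp only [hA₁, Finset.mem_sdiff, Finset.mem_filter, not_and] at hu hv
    obtain ⟨hu, hu'⟩ := hu
    obtain ⟨hv, hv'⟩ := hv
    have hu' := hu' hu
    have hv' := hv' hv
    push Not at hu' hv'
    obtain ⟨a, ha, hua, hau⟩ := hu'
    obtain ⟨b, hb, hvb, hbv⟩ := hv'
    obtain ⟨hH, hsep⟩ := (hadj u hu v hv).1 huv
    have hex : ∃ z ∈ U, z ∈ Set.uIcc u v ∧ ∃ l ∈ U, DelayedRel H U i u l ∧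
        ¬ DelayedRel H U (i + 1) u l ∧ ¬ (H.Adj l z ↔ H.Adj l u) := by
      by_contra hcon
      push Not at hcon
      exact hsep (Or.inr ⟨hAU hu, hAU hv, hA u hu v hv, ⟨a, ha, hua, hau⟩,
        ⟨b, hb, (hE _).trans (hA u hu v hv) hvb, hbv⟩,
        fun z hz hzI l hl h1 h2 => by
          have := hcon z hz hzI l hl h1 h2
          tauto⟩)
    obtain ⟨z, hz, hzI, l, hl, hul, hul', hne⟩ := hex
    have hzY : z ∈ Y := by
      simp only [hY, Finset.mem_filter]
      exact ⟨hz, (hE _).trans (hA a₀ ha₀ u hu) ((hA u hu v hv).convex hz hzI)⟩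
    have hlY : l ∉ Y := fun hlY => hul' (hYrel u (hAY hu) l hlY)
    have hal : DelayedRel H U i a₀ l := (hE _).trans (hA a₀ ha₀ u hu).of_succ hul
    have hwit : ∃ z ∈ Y, ∃ z' ∈ Y, z ∈ Set.uIcc u v ∧ z' ∈ Set.uIcc u v ∧
        H.Adj l z ∧ ¬ H.Adj l z' := by
      by_cases hlz : H.Adj l z
      · exact ⟨z, hzY, u, hAY hu, hzI, Set.left_mem_uIcc, hlz, fun h => hne ⟨fun _ => h, fun _ => hlz⟩⟩
      · refine ⟨u, hAY hu, z, hzY, Set.left_mem_uIcc, hzI, ?_, hlz⟩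
        by_contra h
        exact hne ⟨fun h' => (hlz h').elim, fun h' => (h h').elim⟩
    obtain ⟨z, hz, z', hz', hzI, hzI', hlz, hlz'⟩ := hwit
    -- The class `Y` is convex in `U`, so an outside vertex lies on one side of it.
    have hside : (∀ y ∈ Y, l < y) ∨ ∀ y ∈ Y, y < l := by
      by_contra hcon
      push Not at hcon
      obtain ⟨⟨y, hy, hyl⟩, y', hy', hly'⟩ := hcon
      refine hlY ?_
      simp only [hY, Finset.mem_filter]
      refine ⟨hl, (hE _).trans (Finset.mem_filter.1 hy).2 ?_⟩
      exact (hYrel y hy y' hy').convex hl (Set.mem_uIcc.2 (Or.inl ⟨hyl, hly'⟩))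
    rcases hside with hside | hside
    · exact Or.inl ⟨hH, z, hz, z', hz', hzI, hzI', l, by
        simp only [hL, Finset.mem_filter]; exact ⟨hl, hal, hside⟩, hlz, hlz'⟩
    · exact Or.inr ⟨hH, z, hz, z', hz', hzI, hzI', l, by
        simp only [hR, Finset.mem_filter]; exact ⟨hl, hal, hside⟩, hlz, hlz'⟩
  have hu := hc₁.union hc₂
  rw [Finset.union_sdiff_of_subset (Finset.filter_subset _ _)] at hu
  refine hu.mono ?_
  have : 1 ≤ m ^ k * m ^ k := Nat.one_le_iff_ne_zero.2 (by positivity)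
  calc 1 + m ^ k * m ^ k ≤ 2 * (m ^ k * m ^ k) := by omega
    _ ≤ m * (m ^ k * m ^ k) := Nat.mul_le_mul_right _ hm2
    _ = m ^ (2 * k + 1) := by ring

/-- If all graphs `acrossGraph H L Y` with `L` on one side of `Y` are hereditarily
`m ^ k`-colourable, then `H` is `n ^ (8 * k + 10)`-colourable. -/
theorem colorableOn_of_acrossGraph (k : ℕ)
    (h : ∀ L Y A : Finset V, L ⊆ U → Y ⊆ U → A ⊆ Y →
      ((∀ l ∈ L, ∀ y ∈ Y, l < y) ∨ (∀ l ∈ L, ∀ y ∈ Y, y < l)) →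
      ∀ m, CliqueBound (acrossGraph H L Y) A m → ColorableOn (acrossGraph H L Y) A (m ^ k))
    (n : ℕ) (hn : CliqueBound H U n) : ColorableOn H U (n ^ (8 * k + 10)) := by
  have hE := delayedRel_equivalence (H := H) (U := U)
  -- Taking two depths at a time makes up for the delay: classes at depth `2 * (j + 1) + p` are
  -- modules for the edges of parity `p` inside a class at depth `2 * j + p`.
  have key : ∀ p ≤ 1, ColorableOn (parityGraph H U p) U (n ^ (2 * (2 * k + 1) + 3)) := by
    intro p hp
    refine colorableOn_of_iterated_substitution _ U (fun j => DelayedRel H U (2 * j + p))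
      (fun _ => hE _) ?_ (U.card + 1) (fun _ hx _ hy hxy => hxy.eq (by omega) hx hy) ?_ _
      (colorableOn_delayed_quotient k h p) n
      (hn.mono_graph fun u _ v _ huv => huv.1)
    · intro _ _ _ _
      interval_cases p <;> trivial
    · intro j x hx x' hx' y hy hxy hxy' hxx hadj
      have hx'y : DelayedRel H U (2 * j + p) x' y :=
        (hE _).trans ((hE _).symm (hxx.anti (by omega))) hxy
      have hx'y' : ¬ DelayedRel H U (2 * (j + 1) + p) x' y := fun h' => hxy' ((hE _).trans hxx h')
      rw [parityGraph_adj_iff hxy hxy'] at hadj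
      rw [parityGraph_adj_iff hx'y hx'y']
      refine ⟨?_, fun h' => hadj.2 ((hE _).trans (hxx.anti (by omega)) h')⟩
      rw [show 2 * (j + 1) + p = 2 * j + p + 2 by ring] at hxx
      rcases hxx with rfl | ⟨-, -, -, -, -, htr⟩
      · exact hadj.1
      · exact ((htr x' hx' Set.right_mem_uIcc y hy hxy hadj.2).2 hadj.1.symm).symm
  have := (key 0 (by omega)).prod (key 1 le_rfl) (H := H) (fun u hu v hv huv => ?_)
  · rw [← pow_add] at this
    convert this using 2
    ring
  · classical
    have hex : ∃ i, ¬ DelayedRel H U i u v := ⟨U.card + 1, fun h => huv.ne (h.eq le_rfl hu hv)⟩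
    obtain ⟨i, hi⟩ : ∃ i, Nat.find hex = i + 1 :=
      Nat.exists_eq_succ_of_ne_zero fun h0 => (h0 ▸ Nat.find_spec hex) trivial
    have h1 : ¬ DelayedRel H U (i + 1) u v := hi ▸ Nat.find_spec hex
    have h2 : DelayedRel H U i u v := not_not.1 (Nat.find_min hex (by omega))
    rcases Nat.even_or_odd' i with ⟨j, rfl | rfl⟩
    · exact Or.inl ⟨huv, j, h2, h1⟩
    · exact Or.inr ⟨huv, j, h2, h1⟩

end Delayed

/-- Some vertex of `A` distinguishes two vertices of `B`, and conversely. -/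
def MixedPair {V : Type*} (G : SimpleGraph V) (A B : Set V) : Prop :=
  (∃ a ∈ A, ∃ b ∈ B, ∃ b' ∈ B, G.Adj a b ∧ ¬ G.Adj a b') ∧
    ∃ b ∈ B, ∃ a ∈ A, ∃ a' ∈ A, G.Adj b a ∧ ¬ G.Adj b a'

lemma MixedPair.symm {V : Type*} {G : SimpleGraph V} {A B : Set V} (h : MixedPair G A B) :
    MixedPair G B A := ⟨h.2, h.1⟩

lemma MixedPair.mono {V : Type*} {G : SimpleGraph V} {A B A' B' : Set V} (h : MixedPair G A B)
    (hA : A ⊆ A') (hB : B ⊆ B') : MixedPair G A' B' := by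
  obtain ⟨⟨a, ha, b, hb, b', hb', h1⟩, c, hc, x, hx, y, hy, h2⟩ := h
  exact ⟨⟨a, hA ha, b, hB hb, b', hB hb', h1⟩, c, hB hc, x, hA hx, y, hA hy, h2⟩

/-! ### Chains on one side and the mixed sets they produce -/

section Chains

variable {V : Type*} [LinearOrder V]

/-- The properties shared by `<` and `>` that are used for growing chains on one side. -/
structure IsSide (lt : V → V → Prop) : Prop where
  trans : ∀ {a b c}, lt a b → lt b c → lt a c
  total : ∀ {a b}, a ≠ b → lt a b ∨ lt b a
  mem_uIcc : ∀ {a b x}, lt a b → x ∈ Set.uIcc a b → (x = a ∨ lt a x) ∧ (x = b ∨ lt x b)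
  uIcc_subset : ∀ {a b c}, lt a b → lt b c → Set.uIcc b c ⊆ Set.uIcc a c ∧
    Set.uIcc a b ⊆ Set.uIcc a c
  exists_min : ∀ C : Finset V, C.Nonempty → ∃ w ∈ C, ∀ x ∈ C, x ≠ w → lt w x

lemma isSide_lt : IsSide (fun a b : V => a < b) where
  trans := lt_trans
  total := lt_or_gt_of_ne
  mem_uIcc {a b x} h hx := by
    rw [Set.uIcc_of_le h.le] at hx
    exact ⟨hx.1.eq_or_lt.imp_left Eq.symm, hx.2.eq_or_lt⟩
  uIcc_subset {a b c} h h' := by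
    rw [Set.uIcc_of_le h.le, Set.uIcc_of_le h'.le, Set.uIcc_of_le (h.trans h').le]
    exact ⟨Set.Icc_subset_Icc_left h.le, Set.Icc_subset_Icc_right h'.le⟩
  exists_min C hC := ⟨C.min' hC, C.min'_mem hC, fun _ hx hne =>
    lt_of_le_of_ne (C.min'_le _ hx) hne.symm⟩

lemma isSide_gt : IsSide (fun a b : V => b < a) where
  trans h h' := lt_trans h' h
  total h := (lt_or_gt_of_ne h).symm
  mem_uIcc {a b x} h hx := by
    rw [Set.uIcc_of_ge h.le] at hx
    exact ⟨hx.2.eq_or_lt, hx.1.eq_or_lt.imp_left Eq.symm⟩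
  uIcc_subset {a b c} h h' := by
    rw [Set.uIcc_of_ge h.le, Set.uIcc_of_ge h'.le, Set.uIcc_of_ge (h'.trans h).le]
    exact ⟨Set.Icc_subset_Icc_right h.le, Set.Icc_subset_Icc_left h'.le⟩
  exists_min C hC := ⟨C.max' hC, C.max'_mem hC, fun _ hx hne =>
    lt_of_le_of_ne (C.le_max' _ hx) hne⟩

/-- The edges of `G` whose interval satisfies `Λ`. -/
def intervalGraph (G : SimpleGraph V) (Λ : Set V → Prop) : SimpleGraph V where
  Adj u v := G.Adj u v ∧ Λ (Set.uIcc u v)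
  symm := ⟨fun u v h => by rw [Set.uIcc_comm]; exact ⟨h.1.symm, h.2⟩⟩
  loopless := ⟨fun u h => h.1.ne rfl⟩

/-- One step of a chain: the set `L` and the vertex `w` lie before `U`, some vertex of `L`
distinguishes two vertices in each interval satisfying `Λ`, and the vertices of `U` look alike
from `L`. -/
structure ChainStep (lt : V → V → Prop) (G : SimpleGraph V) (U₀ : Finset V) (Λ₀ : Set V → Prop)
    (L : Finset V) (w : V) (U : Finset V) (Λ : Set V → Prop) : Prop where
  left_sub : L ⊆ U₀
  nonempty : L.Nonempty
  sub : U ⊆ U₀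
  mem : w ∈ U₀
  lt_mid : ∀ l ∈ L, lt l w
  mid_lt : ∀ u ∈ U, lt w u
  le : ∀ I, Λ I → Λ₀ I
  long : ∃ l ∈ L, Λ₀ (Set.uIcc l w)
  cross : ∀ I, Λ I → ∃ z ∈ U₀, ∃ z' ∈ U₀, z ∈ I ∧ z' ∈ I ∧ ∃ l ∈ L, G.Adj l z ∧ ¬ G.Adj l z'
  flat : (∀ u ∈ U, ∃ l ∈ L, ∃ l' ∈ L, G.Adj u l ∧ ¬ G.Adj u l') ∨
    (∀ u ∈ U, ∀ l ∈ L, G.Adj u l) ∨ ∀ u ∈ U, ∀ l ∈ L, ¬ G.Adj u l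

/-- There is a chain of `j` steps that ends in `U` and `Λ`. -/
def HasChain (lt : V → V → Prop) (G : SimpleGraph V) : ℕ → Finset V → (Set V → Prop) → Prop
  | 0 => fun _ _ => True
  | j + 1 => fun U Λ => ∃ U₀ Λ₀ L w, HasChain lt G j U₀ Λ₀ ∧ ChainStep lt G U₀ Λ₀ L w U Λ

lemma HasChain.mono {lt : V → V → Prop} {G : SimpleGraph V} {j : ℕ} {U U' : Finset V}
    {Λ Λ' : Set V → Prop} (h : HasChain lt G j U Λ) (hU : U' ⊆ U) (hΛ : ∀ I, Λ' I → Λ I) :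
    HasChain lt G j U' Λ' := by
  cases j with
  | zero => trivial
  | succ j =>
    obtain ⟨U₀, Λ₀, L, w, h0, h⟩ := h
    exact ⟨U₀, Λ₀, L, w, h0,
      { h with
        sub := hU.trans h.sub
        mid_lt := fun u hu => h.mid_lt u (hU hu)
        le := fun I hI => h.le I (hΛ I hI)
        cross := fun I hI => h.cross I (hΛ I hI)
        flat := h.flat.imp (fun h u hu => h u (hU hu))
          (Or.imp (fun h u hu => h u (hU hu)) (fun h u hu => h u (hU hu))) }⟩

/-- Colouring `acrossGraph` through the graphs obtained by one more chain step. -/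
lemma colorableOn_acrossGraph_of_chainStep {lt : V → V → Prop} (hs : IsSide lt)
    (G : SimpleGraph V) (U : Finset V) (Λ : Set V → Prop) (hΛ : ∀ I J, I ⊆ J → Λ I → Λ J)
    (L Y A : Finset V) (hL : L ⊆ U) (hY : Y ⊆ U) (hA : A ⊆ Y) (hLY : ∀ l ∈ L, ∀ y ∈ Y, lt l y)
    (k : ℕ)
    (ih : ∀ U' Λ' w, U' ⊆ U → (∀ I J, I ⊆ J → Λ' I → Λ' J) → (∀ I, Λ' I → Λ I) →
      ChainStep lt G U Λ L w U' Λ' → ∀ m, CliqueBound (intervalGraph G Λ') U' m →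
        ColorableOn (intervalGraph G Λ') U' (m ^ k))
    (m : ℕ) (hm : CliqueBound (acrossGraph (intervalGraph G Λ) L Y) A m) :
    ColorableOn (acrossGraph (intervalGraph G Λ) L Y) A (m ^ (k + 3)) := by
  classical
  set H := intervalGraph G Λ with hH
  by_cases hno : ∀ u ∈ A, ∀ v ∈ A, ¬ (acrossGraph H L Y).Adj u v
  · exact hm.colorableOn_of_no_adj _ hno
  push Not at hno
  obtain ⟨a₀, ha₀, b₀, hb₀, hab₀⟩ := hno
  have hm2 : 2 ≤ m := hm.two_le ha₀ hb₀ hab₀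
  have hLne : L.Nonempty := by
    obtain ⟨-, -, -, -, -, -, -, l, hl, -⟩ := hab₀
    exact ⟨l, hl⟩
  have hbig : m ^ k * 3 + 2 ≤ m ^ (k + 3) := by
    have h1 : 1 ≤ m ^ k := Nat.one_le_iff_ne_zero.2 (by positivity)
    have h2 : 2 ^ 3 ≤ m ^ 3 := Nat.pow_le_pow_left hm2 3
    rw [pow_add]
    nlinarith
  -- `F` is independent: the interval of an edge inside it satisfies `Λ` and lies in the interval
  -- from any `l` to the endpoint farther from `L`. Off `F`, adjacency to `L` in `H` and in `G`
  -- agree.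
  set F := A.filter fun x => ∃ l ∈ L, ¬ Λ (Set.uIcc l x) with hF
  set C := A \ F with hC
  have hcF : ColorableOn (acrossGraph H L Y) F 1 := by
    refine colorableOn_one fun u hu v hv huv => ?_
    wlog h : lt u v generalizing u v
    · exact this v hv u hu huv.symm ((hs.total huv.ne).resolve_left h)
    obtain ⟨l, hl, hlv⟩ := (Finset.mem_filter.1 hv).2
    have hlu := hLY l hl u (hA (Finset.mem_filter.1 hu).1)
    exact hlv (hΛ _ _ (hs.uIcc_subset hlu h).1 huv.1.2)
  rcases C.eq_empty_or_nonempty with hCe | hCne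
  · have : A ⊆ F := Finset.sdiff_eq_empty_iff_subset.1 hCe
    exact (hcF.subset this).mono (by omega)
  -- Giving up the vertex of `C` nearest to `L` costs one colour. It provides an interval from `L`
  -- that satisfies `Λ` and ends before all remaining vertices.
  obtain ⟨w, hwC, hwmin⟩ := hs.exists_min C hCne
  have hCmem : ∀ x ∈ C, x ∈ A ∧ ∀ l ∈ L, Λ (Set.uIcc l x) := fun x hx => by
    have := Finset.mem_sdiff.1 hx
    refine ⟨this.1, fun l hl => ?_⟩
    by_contra hcon
    exact this.2 (Finset.mem_filter.2 ⟨this.1, l, hl, hcon⟩)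
  set B := C.erase w with hB
  set Λ' : Set V → Prop := fun I => Λ I ∧ ∃ z ∈ Y, ∃ z' ∈ Y, z ∈ I ∧ z' ∈ I ∧
    ∃ l ∈ L, G.Adj l z ∧ ¬ G.Adj l z' with hΛ'
  have hadj : ∀ u ∈ B, ∀ v ∈ B, ((acrossGraph H L Y).Adj u v ↔ (intervalGraph G Λ').Adj u v) := by
    intro u hu v hv
    wlog h : lt u v generalizing u v
    · by_cases huv : u = v
      · subst huv
        simp
      · rw [SimpleGraph.adj_comm, this v hv u hu ((hs.total huv).resolve_left h),
          SimpleGraph.adj_comm]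
    have hlong : ∀ z ∈ Set.uIcc u v, ∀ l ∈ L, Λ (Set.uIcc l z) := by
      intro z hz l hl
      have hu' := hCmem u (Finset.mem_of_mem_erase hu)
      rcases (hs.mem_uIcc h hz).1 with rfl | huz
      · exact hu'.2 l hl
      · exact hΛ _ _ (hs.uIcc_subset (hLY l hl u (hA hu'.1)) huz).2 (hu'.2 l hl)
    constructor
    · rintro ⟨h1, z, hz, z', hz', hzI, hzI', l, hl, hlz, hlz'⟩
      exact ⟨h1.1, h1.2, z, hz, z', hz', hzI, hzI', l, hl, hlz.1,
        fun h2 => hlz' ⟨h2, hlong z' hzI' l hl⟩⟩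
    · rintro ⟨h1, h2, z, hz, z', hz', hzI, hzI', l, hl, hlz, hlz'⟩
      exact ⟨⟨h1, h2⟩, z, hz, z', hz', hzI, hzI', l, hl, ⟨hlz, hlong z hzI l hl⟩,
        fun h2 => hlz' h2.1⟩
  have hBA : B ⊆ A := (Finset.erase_subset _ _).trans Finset.sdiff_subset
  have hpiece : ∀ B' ⊆ B, ((∀ u ∈ B', ∃ l ∈ L, ∃ l' ∈ L, G.Adj u l ∧ ¬ G.Adj u l') ∨
      (∀ u ∈ B', ∀ l ∈ L, G.Adj u l) ∨ ∀ u ∈ B', ∀ l ∈ L, ¬ G.Adj u l) →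
      ColorableOn (acrossGraph H L Y) B' (m ^ k) := by
    intro B' hB' hflat
    have hstep : ChainStep lt G U Λ L w B' Λ' :=
      { left_sub := hL
        nonempty := hLne
        sub := hB'.trans (hBA.trans (hA.trans hY))
        mem := hY (hA (hCmem w hwC).1)
        lt_mid := fun l hl => hLY l hl w (hA (hCmem w hwC).1)
        mid_lt := fun u hu =>
          hwmin u (Finset.mem_of_mem_erase (hB' hu)) (Finset.ne_of_mem_erase (hB' hu))
        le := fun I hI => hI.1
        long := hLne.imp fun l hl => ⟨hl, (hCmem w hwC).2 l hl⟩
        cross := fun I ⟨_, z, hz, z', hz', h⟩ => ⟨z, hY hz, z', hY hz', h⟩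
        flat := hflat }
    refine (ih B' Λ' w hstep.sub ?_ hstep.le hstep m ?_).mono_graph
      fun u hu v hv => (hadj u (hB' hu) v (hB' hv)).1
    · rintro I J hIJ ⟨h1, z, hz, z', hz', hzI, hzI', h⟩
      exact ⟨hΛ I J hIJ h1, z, hz, z', hz', hIJ hzI, hIJ hzI', h⟩
    · exact (hm.mono_set (hB'.trans hBA)).mono_graph
        fun u hu v hv => (hadj u (hB' hu) v (hB' hv)).2
  -- Three flat types plus one colour each for `F` and `w`: `3 * m ^ k + 2` colours, which is at
  -- most `m ^ (k + 3)` as `m ≥ 2`.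
  have hc := (((hpiece (B.filter fun u => ∃ l ∈ L, ∃ l' ∈ L, G.Adj u l ∧ ¬ G.Adj u l')
      (Finset.filter_subset _ _) (Or.inl fun u hu => (Finset.mem_filter.1 hu).2)).union
    (hpiece (B.filter fun u => ∀ l ∈ L, G.Adj u l)
      (Finset.filter_subset _ _) (Or.inr (Or.inl fun u hu => (Finset.mem_filter.1 hu).2)))).union
    (hpiece (B.filter fun u => ∀ l ∈ L, ¬ G.Adj u l)
      (Finset.filter_subset _ _) (Or.inr (Or.inr fun u hu => (Finset.mem_filter.1 hu).2)))).union
    (hcF.union (colorableOn_one (H := acrossGraph H L Y) (A := {w}) (by simp)))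
  refine (hc.subset fun x hx => ?_).mono (by omega)
  simp only [Finset.mem_union, Finset.mem_filter, Finset.mem_singleton]
  by_cases hxF : x ∈ F
  · exact Or.inr (Or.inl hxF)
  by_cases hxw : x = w
  · exact Or.inr (Or.inr hxw)
  have hxB : x ∈ B := Finset.mem_erase.2 ⟨hxw, Finset.mem_sdiff.2 ⟨hx, hxF⟩⟩
  left
  by_cases h1 : ∀ l ∈ L, G.Adj x l
  · exact Or.inl (Or.inr ⟨hxB, h1⟩)
  by_cases h2 : ∀ l ∈ L, ¬ G.Adj x l
  · exact Or.inr ⟨hxB, h2⟩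
  push Not at h1 h2
  obtain ⟨l', hl', h1⟩ := h1
  obtain ⟨l, hl, h2⟩ := h2
  exact Or.inl (Or.inl ⟨hxB, l, hl, l', hl', h2, h1⟩)

/-- The exponent that suffices when at most `t` more chain steps are possible. -/
def chainExponent : ℕ → ℕ
  | 0 => 0
  | t + 1 => 8 * (chainExponent t + 3) + 10

lemma chainExponent_le (t : ℕ) : chainExponent t + 5 ≤ 5 * 8 ^ t := by
  induction t with
  | zero => simp [chainExponent]
  | succ t ih => rw [chainExponent, pow_succ]; omega

/-- If no chain has length `s`, then the graph is polynomially colourable. -/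
theorem colorableOn_of_no_chain (G : SimpleGraph V) (s : ℕ)
    (hl : ∀ U Λ, U.Nonempty → ¬ HasChain (fun a b : V => a < b) G s U Λ)
    (hr : ∀ U Λ, U.Nonempty → ¬ HasChain (fun a b : V => b < a) G s U Λ) (t : ℕ) :
    ∀ i j, i ≤ s → j ≤ s → i + j + t = 2 * s → ∀ U Λ, (∀ I J, I ⊆ J → Λ I → Λ J) →
      HasChain (fun a b : V => a < b) G i U Λ → HasChain (fun a b : V => b < a) G j U Λ →
      ∀ n, CliqueBound (intervalGraph G Λ) U n →
        ColorableOn (intervalGraph G Λ) U (n ^ chainExponent t) := by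
  induction t with
  | zero =>
    intro i j hi hj hij U Λ _ hci _ n _
    rcases U.eq_empty_or_nonempty with rfl | hU
    · exact colorableOn_empty
    · obtain rfl : i = s := by omega
      exact (hl U Λ hU hci).elim
  | succ t ih =>
    intro i j hi hj hij U Λ hΛ hci hcj n hn
    rcases U.eq_empty_or_nonempty with rfl | hU
    · exact colorableOn_empty
    rcases hi.eq_or_lt with rfl | hi
    · exact (hl U Λ hU hci).elim
    rcases hj.eq_or_lt with rfl | hj
    · exact (hr U Λ hU hcj).elim
    refine colorableOn_of_acrossGraph (chainExponent t + 3) ?_ n hn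
    rintro L Y A hL hY hA (hLY | hLY) m hm
    · refine colorableOn_acrossGraph_of_chainStep isSide_lt G U Λ hΛ L Y A hL hY hA hLY _ ?_ m hm
      intro U' Λ' w hU' hΛ' hle hstep
      exact ih (i + 1) j hi hj.le (by omega) U' Λ' hΛ' ⟨U, Λ, L, w, hci, hstep⟩
        (hcj.mono hU' hle)
    · refine colorableOn_acrossGraph_of_chainStep isSide_gt G U Λ hΛ L Y A hL hY hA hLY _ ?_ m hm
      intro U' Λ' w hU' hΛ' hle hstep
      exact ih i (j + 1) hi.le hj (by omega) U' Λ' hΛ' (hci.mono hU' hle)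
        ⟨U, Λ, L, w, hcj, hstep⟩

/-- A chain of length `2 * j` contains `j` consecutive pairwise mixed sets. -/
theorem HasChain.exists_mixed {lt : V → V → Prop} (hs : IsSide lt) {G : SimpleGraph V} (j : ℕ) :
    ∀ {U Λ}, HasChain lt G (2 * j) U Λ → ∃ S : ℕ → Set V,
      (∀ a b, a < b → b < j → ∀ x ∈ S a, ∀ y ∈ S b, lt x y) ∧
      (∀ a < j, ∀ x ∈ S a, ∀ u ∈ U, lt x u) ∧
      (∀ a b, a < b → b < j → MixedPair G (S a) (S b)) ∧
      ∀ a < j, ∀ I, Λ I → MixedPair G (S a) I := by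
  induction j with
  | zero => intro U Λ _; exact ⟨fun _ => ∅, by simp, by simp, by simp, by simp⟩
  | succ j ih =>
    rintro U Λ ⟨U₀, Λ₀, L', w', ⟨U₁, Λ₁, L, w, h1, hw⟩, hw'⟩
    obtain ⟨S, hS1, hS2, hS3, hS4⟩ := ih h1
    obtain ⟨l₀, hl₀, hlong⟩ := hw'.long
    -- The interval from `l₀` to `w'` makes `T` mixed with all earlier sets. `L'` distinguishes
    -- vertices in every later interval, and `L` serves for the converse.
    set T : Set V := L ∪ L' ∪ Set.uIcc l₀ w' with hT
    have hlt0 : lt l₀ w' := hw'.lt_mid l₀ hl₀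
    have hST : ∀ a < j, ∀ x ∈ S a, ∀ y ∈ T, lt x y := by
      rintro a ha x hx y ((hy | hy) | hy)
      · exact hS2 a ha x hx y (hw.left_sub hy)
      · exact hS2 a ha x hx y (hw.sub (hw'.left_sub hy))
      · have h2 := hS2 a ha x hx l₀ (hw.sub (hw'.left_sub hl₀))
        rcases (hs.mem_uIcc hlt0 hy).1 with rfl | h
        · exact h2
        · exact hs.trans h2 h
    have hSTm : ∀ a < j, MixedPair G (S a) T := fun a ha =>
      (hS4 a ha _ (hw.le _ hlong)).mono subset_rfl Set.subset_union_right
    refine ⟨fun a => if a < j then S a else T, ?_, ?_, ?_, ?_⟩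
    · intro a b hab hb
      have ha : a < j := by omega
      by_cases hbj : b < j
      · simpa [ha, hbj] using hS1 a b hab hbj
      · simpa [ha, hbj] using hST a ha
    · intro a _
      by_cases haj : a < j
      · simp only [haj, if_true]
        exact fun x hx u hu => hS2 a haj x hx u (hw.sub (hw'.sub hu))
      · simp only [haj, if_false]
        rintro x ((hx | hx) | hx) u hu
        · exact hs.trans (hw.lt_mid x hx) (hw.mid_lt u (hw'.sub hu))
        · exact hs.trans (hw'.lt_mid x hx) (hw'.mid_lt u hu)
        · rcases (hs.mem_uIcc hlt0 hx).2 with rfl | h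
          · exact hw'.mid_lt u hu
          · exact hs.trans h (hw'.mid_lt u hu)
    · intro a b hab hb
      have ha : a < j := by omega
      by_cases hbj : b < j
      · simpa [ha, hbj] using hS3 a b hab hbj
      · simpa [ha, hbj] using hSTm a ha
    · intro a _ I hI
      by_cases haj : a < j
      · simp only [haj, if_true]
        exact hS4 a haj I (hw.le _ (hw'.le _ hI))
      · simp only [haj, if_false]
        obtain ⟨z, hz, z', hz', hzI, hzI', l, hl, hlz, hlz'⟩ := hw'.cross I hI
        have hlT : l ∈ T := Or.inl (Or.inr hl)
        have hLT : ∀ x ∈ L, x ∈ T := fun x hx => Or.inl (Or.inl hx)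
        refine ⟨⟨l, hlT, z, hzI, z', hzI', hlz, hlz'⟩, ?_⟩
        obtain ⟨x, hx⟩ := hw.nonempty
        -- The vertices `z` and `z'` look alike from `L`. If they are not mixed on `L`, then the
        -- vertex `l` of `L'` disagrees with `L` as seen from one of them.
        rcases hw.flat with h | h | h
        · obtain ⟨y, hy, y', hy', h⟩ := h z hz
          exact ⟨z, hzI, y, hLT y hy, y', hLT y' hy', h⟩
        · exact ⟨z', hzI', x, hLT x hx, l, hlT, h z' hz' x hx, fun h => hlz' h.symm⟩
        · exact ⟨z, hzI, l, hlT, x, hLT x hx, hlz.symm, h z hz x hx⟩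

end Chains

/-! ### From mixed sets to almost mixed minors, and the exponent -/

lemma not_matrixAlmostMixedFree_of_mixedPairs {V : Type u} (G : SimpleGraph V) {n d : ℕ}
    (hd : 2 ≤ d) (v : Fin n ≃ V) (S : ℕ → Set (Fin n))
    (hS : ∀ a b, a < b → b < d → ∀ x ∈ S a, ∀ y ∈ S b, x < y)
    (hm : ∀ a b, a < b → b < d → MixedPair (G.comap v) (S a) (S b)) :
    ¬ MatrixAlmostMixedFree d (orderedAdjMatrix G v) := by
  classical
  have hne : ∀ a < d, (S a).Nonempty := by
    intro a ha
    by_cases h : a + 1 < d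
    · obtain ⟨⟨x, hx, _⟩, _⟩ := hm a (a + 1) (by omega) h
      exact ⟨x, hx⟩
    · obtain ⟨_, ⟨x, hx, _⟩⟩ := hm (a - 1) a (by omega) ha
      exact ⟨x, hx⟩
  have hm' : ∀ a b, a < d → b < d → a ≠ b → MixedPair (G.comap v) (S a) (S b) := by
    intro a b ha hb hab
    rcases lt_or_gt_of_ne hab with h | h
    · exact hm a b h hb
    · exact (hm b a h ha).symm
  -- Counts which of `S 1, …, S (d - 1)` have begun by `x`; a new block starts with the first vertex
  -- of each of them, and the same cuts serve rows and columns.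
  let cnt : Fin n → ℕ := fun x =>
    ((Finset.range (d - 1)).filter fun i => ∃ s ∈ S (i + 1), s ≤ x).card
  have hlt : ∀ x, cnt x < d := fun x =>
    ((Finset.card_filter_le _ _).trans_eq (Finset.card_range _)).trans_lt (by omega)
  have hcnt : ∀ a < d, ∀ x ∈ S a, cnt x = a := by
    intro a ha x hx
    have : ((Finset.range (d - 1)).filter fun i => ∃ s ∈ S (i + 1), s ≤ x) = Finset.range a := by
      ext i
      simp only [Finset.mem_filter, Finset.mem_range]
      constructor
      · rintro ⟨hi, s, hs, hsx⟩
        by_contra h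
        exact absurd (hS a (i + 1) (by omega) (by omega) x hx s hs) hsx.not_gt
      · intro hi
        refine ⟨by omega, ?_⟩
        rcases (show i + 1 ≤ a from hi).eq_or_lt with h | h
        · exact ⟨x, h ▸ hx, le_rfl⟩
        · obtain ⟨s, hs⟩ := hne (i + 1) (by omega)
          exact ⟨s, hs, (hS _ _ h ha s hs x hx).le⟩
    exact (congrArg Finset.card this).trans (Finset.card_range a)
  let R : IntervalPartition n d :=
    { block := fun x => ⟨cnt x, hlt x⟩
      monotone_block := fun x y hxy => Fin.mk_le_mk.2 <| Finset.card_le_card <|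
        Finset.monotone_filter_right _ fun i _ hi => hi.imp fun s hs => ⟨hs.1, hs.2.trans hxy⟩
      surjective_block := fun a => (hne a a.2).imp fun x hx => Fin.ext (hcnt a a.2 x hx) }
  have hR : ∀ (a : Fin d), ∀ x ∈ S a, R.block x = a := fun a x hx => Fin.ext (hcnt a a.2 x hx)
  have hent : ∀ x y z t : Fin n, G.Adj (v x) (v y) → ¬ G.Adj (v z) (v t) →
      orderedAdjMatrix G v x y ≠ orderedAdjMatrix G v z t := by
    intro x y z t h1 h2
    have hxy : x ≠ y := by rintro rfl; exact h1.ne rfl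
    simp only [orderedAdjMatrix, hxy, h1, h2, if_false, if_true]
    split_ifs <;> simp
  intro hfree
  refine hfree ⟨R, R⟩ fun a b hab => Or.inl ?_
  obtain ⟨⟨x, hx, y, hy, y', hy', h1, h2⟩, ⟨z, hz, t, ht, t', ht', h3, h4⟩⟩ :=
    hm' a b a.2 b.2 (fun h => hab (Fin.ext h))
  refine ⟨fun h => ?_, fun h => ?_⟩
  · exact hent x y x y' h1 h2 (h ⟨x, hR a x hx⟩ ⟨y, hR b y hy⟩ ⟨y', hR b y' hy'⟩)
  · exact hent t z t' z h3.symm (fun h => h4 h.symm)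
      (h ⟨t, hR a t ht⟩ ⟨t', hR a t' ht'⟩ ⟨z, hR b z hz⟩)

lemma not_hasChain_lt {V : Type u} {G : SimpleGraph V} {n d : ℕ} (hd : 2 ≤ d) {v : Fin n ≃ V}
    (hfree : MatrixAlmostMixedFree d (orderedAdjMatrix G v)) (U : Finset (Fin n))
    (Λ : Set (Fin n) → Prop) :
    ¬ HasChain (fun a b : Fin n => a < b) (G.comap v) (2 * d) U Λ := by
  intro h
  obtain ⟨S, h1, -, h2, -⟩ := h.exists_mixed isSide_lt
  exact not_matrixAlmostMixedFree_of_mixedPairs G hd v S h1 h2 hfree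

lemma not_hasChain_gt {V : Type u} {G : SimpleGraph V} {n d : ℕ} (hd : 2 ≤ d) {v : Fin n ≃ V}
    (hfree : MatrixAlmostMixedFree d (orderedAdjMatrix G v)) (U : Finset (Fin n))
    (Λ : Set (Fin n) → Prop) :
    ¬ HasChain (fun a b : Fin n => b < a) (G.comap v) (2 * d) U Λ := by
  intro h
  obtain ⟨S, h1, -, h2, -⟩ := h.exists_mixed isSide_gt
  refine not_matrixAlmostMixedFree_of_mixedPairs G hd v (fun a => S (d - 1 - a)) ?_ ?_ hfree
  · exact fun a b hab hb x hx y hy => h1 (d - 1 - b) (d - 1 - a) (by omega) (by omega) y hy x hx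
  · exact fun a b hab hb => (h2 (d - 1 - b) (d - 1 - a) (by omega) (by omega)).symm

theorem chromaticNumber_le_of_graphAlmostMixedFree {V : Type u} [Fintype V] {G : SimpleGraph V}
    {d : ℕ} (hd : 2 ≤ d) (h : GraphAlmostMixedFree d G) :
    G.chromaticNumber ≤ ((G.cliqueNum ^ chainExponent (4 * d) : ℕ) : ℕ∞) := by
  classical
  obtain ⟨v, hfree⟩ := h
  have hclique : CliqueBound (intervalGraph (G.comap v) fun _ => True) Finset.univ G.cliqueNum := by
    intro K _ hK
    have : G.IsClique (K.map v.toEmbedding : Set V) := by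
      intro x hx y hy hxy
      simp only [Finset.coe_map, Set.mem_image, Finset.mem_coe] at hx hy
      obtain ⟨x, hx, rfl⟩ := hx
      obtain ⟨y, hy, rfl⟩ := hy
      exact (hK hx hy fun h => hxy (h ▸ rfl)).1
    simpa using this.card_le_cliqueNum
  obtain ⟨c, hc, hp⟩ := colorableOn_of_no_chain (G.comap v) (2 * d)
    (fun U Λ _ => not_hasChain_lt hd hfree U Λ) (fun U Λ _ => not_hasChain_gt hd hfree U Λ)
    (4 * d) 0 0 (by omega) (by omega) (by omega) Finset.univ (fun _ => True)
    (fun _ _ _ h => h) trivial trivial _ hclique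
  refine SimpleGraph.Colorable.chromaticNumber_le ⟨SimpleGraph.Coloring.mk
    (fun x => ⟨c (v.symm x), hc _ (Finset.mem_univ _)⟩) ?_⟩
  intro x y hxy h
  refine hp (v.symm x) (Finset.mem_univ _) (v.symm y) (Finset.mem_univ _)
    ⟨by simpa using hxy, trivial⟩
    (congrArg Fin.val h)

/-- A division into one part has no off-diagonal zone, so it is vacuously a minor as soon as there
is a vertex. -/
lemma isEmpty_of_graphAlmostMixedFree_one {V : Type u} [Fintype V] {G : SimpleGraph V}
    (h : GraphAlmostMixedFree 1 G) : IsEmpty V := by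
  obtain ⟨v, hv⟩ := h
  by_contra hne
  rw [not_isEmpty_iff] at hne
  obtain ⟨x⟩ := hne
  let R : IntervalPartition (Fintype.card V) 1 :=
    ⟨fun _ => 0, monotone_const, fun a => ⟨v.symm x, Subsingleton.elim _ _⟩⟩
  exact hv ⟨R, R⟩ fun a b hab => (hab (Subsingleton.elim _ _)).elim

/-- The exponent of the polynomial `χ`-bounding function of `d`-almost mixed free graphs. -/
def boundingExponent (d : ℕ) : ℕ := if d ≤ 1 then 0 else chainExponent (4 * d)

/-- The exponent is in fact at most `2 ^ (15 * d)`, and `d ≥ 2` in the nontrivial case. -/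
lemma boundingExponent_le (d : ℕ) : boundingExponent d ≤ d ^ (15 * d) := by
  unfold boundingExponent
  split_ifs with h
  · exact Nat.zero_le _
  · have h1 := chainExponent_le (4 * d)
    calc chainExponent (4 * d) ≤ 8 * 8 ^ (4 * d) := by omega
      _ = 2 ^ (3 * (4 * d + 1)) := by rw [← pow_succ', pow_mul 2 3]; norm_num
      _ ≤ 2 ^ (15 * d) := Nat.pow_le_pow_right (by norm_num) (by omega)
      _ ≤ d ^ (15 * d) := Nat.pow_le_pow_left (by omega) _

theorem chromaticNumber_le_cliqueNum_pow {V : Type u} [Fintype V] {G : SimpleGraph V} {d : ℕ}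
    (hd : 1 ≤ d) (h : GraphAlmostMixedFree d G) :
    G.chromaticNumber ≤ ((G.cliqueNum ^ boundingExponent d : ℕ) : ℕ∞) := by
  unfold boundingExponent
  split_ifs with h1
  · obtain rfl : d = 1 := by omega
    have := isEmpty_of_graphAlmostMixedFree_one h
    rw [SimpleGraph.chromaticNumber_eq_zero_of_isEmpty]
    exact bot_le
  · exact chromaticNumber_le_of_graphAlmostMixedFree (by omega) h

/-! ### Vertex orderings adapted to contraction sequences -/

section Contractions

variable {V : Type u} {P Q : Set (Set V)}

lemma eq_of_mem_parts (hP : Setoid.IsPartition P) {A B : Set V} (hA : A ∈ P) (hB : B ∈ P) {x : V}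
    (hxA : x ∈ A) (hxB : x ∈ B) : A = B :=
  (hP.2 x).unique ⟨hA, hxA⟩ ⟨hB, hxB⟩

lemma union_notMem_parts (hP : Setoid.IsPartition P) {A B : Set V} (hA : A ∈ P) (hB : B ∈ P)
    (hAB : A ≠ B) : A ∪ B ∉ P := by
  intro h
  obtain ⟨x, hx⟩ := Setoid.nonempty_of_mem_partition hP hA
  obtain ⟨y, hy⟩ := Setoid.nonempty_of_mem_partition hP hB
  exact hAB ((eq_of_mem_parts hP hA h hx (Or.inl hx)).trans
    (eq_of_mem_parts hP hB h hy (Or.inr hy)).symm)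

lemma IsContraction.isPartition (h : IsContraction P Q) (hP : Setoid.IsPartition P) :
    Setoid.IsPartition Q := by
  obtain ⟨A, hA, B, hB, -, rfl⟩ := h
  refine ⟨?_, fun x => ?_⟩
  · rintro (h | h)
    · obtain ⟨x, hx⟩ := Setoid.nonempty_of_mem_partition hP hA
      exact (h ▸ (Or.inl hx : x ∈ A ∪ B) : x ∈ (∅ : Set V))
    · exact hP.1 h.1
  · have hout : ∀ C ∈ P \ {A, B}, x ∈ A ∪ B → x ∉ C := by
      rintro C ⟨hC, hC'⟩ (hx | hx) hxC
      · exact hC' (Or.inl (eq_of_mem_parts hP hC hA hxC hx))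
      · exact hC' (Or.inr (eq_of_mem_parts hP hC hB hxC hx))
    by_cases hx : x ∈ A ∪ B
    · refine ⟨A ∪ B, ⟨Or.inl rfl, hx⟩, ?_⟩
      rintro C ⟨rfl | hC, hxC⟩
      · rfl
      · exact (hout C hC hx hxC).elim
    · obtain ⟨C, ⟨hC, hxC⟩, huniq⟩ := hP.2 x
      refine ⟨C, ⟨Or.inr ⟨hC, ?_⟩, hxC⟩, ?_⟩
      · rintro (rfl | rfl)
        · exact hx (Or.inl hxC)
        · exact hx (Or.inr hxC)
      · rintro D ⟨rfl | hD, hxD⟩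
        · exact (hx hxD).elim
        · exact huniq D ⟨hD.1, hxD⟩

lemma IsContraction.ncard_add_one [Finite V] (h : IsContraction P Q)
    (hP : Setoid.IsPartition P) : Q.ncard + 1 = P.ncard := by
  obtain ⟨A, hA, B, hB, hAB, rfl⟩ := h
  have hsub : ({A, B} : Set (Set V)) ⊆ P := by rintro C (rfl | rfl) <;> assumption
  rw [Set.ncard_insert_of_notMem fun h => union_notMem_parts hP hA hB hAB h.1]
  have h1 := Set.ncard_sdiff_add_ncard_of_subset hsub
  rw [Set.ncard_pair hAB] at h1
  omega

lemma isPartition_singletons : Setoid.IsPartition (Set.range fun x : V => ({x} : Set V)) := by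
  refine ⟨?_, fun x => ⟨{x}, ⟨⟨x, rfl⟩, rfl⟩, ?_⟩⟩
  · rintro ⟨x, hx⟩
    exact Set.singleton_ne_empty x hx
  · rintro _ ⟨⟨y, rfl⟩, rfl⟩
    rfl

lemma getElem_mem_of_infix {L m : List V} (hL : L.Nodup) (hm : m <:+: L) {i j k : ℕ}
    (hij : i ≤ j) (hjk : j ≤ k) (hk : k < L.length) (hi : L[i] ∈ m) (hk' : L[k] ∈ m) :
    L[j] ∈ m := by
  obtain ⟨p, q, rfl⟩ := hm
  have key : ∀ a (ha : a < (p ++ m ++ q).length), (p ++ m ++ q)[a] ∈ m →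
      p.length ≤ a ∧ a < p.length + m.length := by
    intro a ha h
    obtain ⟨b, hb, hab⟩ := List.getElem_of_mem h
    have hb' : p.length + b < (p ++ m ++ q).length := by simp; omega
    have : (p ++ m ++ q)[p.length + b] = m[b] := by
      rw [List.getElem_append_left (by simpa using hb), List.getElem_append_right (by omega)]
      simp
    have := (hL.getElem_inj_iff).1 (this.trans hab)
    omega
  have h1 := key i _ hi
  have h2 := key k _ hk'
  rw [List.getElem_append_left (by simp; omega), List.getElem_append_right (by omega)]
  exact List.getElem_mem _

variable [Fintype V] {S : ℕ → Set (Set V)}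

lemma isPartition_of_isContraction (h0 : S 0 = Set.range fun x : V => ({x} : Set V))
    (hS : ∀ i, i + 1 < Fintype.card V → IsContraction (S i) (S (i + 1))) :
    ∀ i < Fintype.card V, Setoid.IsPartition (S i) ∧ (S i).ncard + i = Fintype.card V := by
  intro i
  induction i with
  | zero =>
    intro _
    rw [h0]
    refine ⟨isPartition_singletons, ?_⟩
    rw [← Set.image_univ, Set.ncard_image_of_injective _ Set.singleton_injective,
      Set.ncard_univ, Nat.card_eq_fintype_card, add_zero]
  | succ i ih =>
    intro hi
    obtain ⟨h1, h2⟩ := ih (by omega)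
    have h3 := (hS i hi).ncard_add_one h1
    exact ⟨(hS i hi).isPartition h1, by omega⟩

lemma univ_mem_last (h0 : S 0 = Set.range fun x : V => ({x} : Set V))
    (hS : ∀ i, i + 1 < Fintype.card V → IsContraction (S i) (S (i + 1)))
    (hV : 0 < Fintype.card V) : Set.univ ∈ S (Fintype.card V - 1) := by
  obtain ⟨h1, h2⟩ := isPartition_of_isContraction h0 hS (Fintype.card V - 1) (by omega)
  obtain ⟨A, hA⟩ := Set.ncard_eq_one.1 (show (S (Fintype.card V - 1)).ncard = 1 by omega)
  have : A = Set.univ := by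
    refine Set.eq_univ_of_forall fun x => ?_
    obtain ⟨B, ⟨hB, hx⟩, -⟩ := h1.2 x
    rw [hA, Set.mem_singleton_iff] at hB
    exact hB ▸ hx
  rw [hA, this]
  rfl

/-- The parts of the `i`-th partition can be listed so that each part of an earlier partition is
listed consecutively. -/
lemma exists_lists (h0 : S 0 = Set.range fun x : V => ({x} : Set V))
    (hS : ∀ i, i + 1 < Fintype.card V → IsContraction (S i) (S (i + 1))) :
    ∀ i < Fintype.card V, ∃ l : Set V → List V,
      (∀ A ∈ S i, (l A).Nodup ∧ ∀ x, x ∈ l A ↔ x ∈ A) ∧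
      ∀ j ≤ i, ∀ B ∈ S j, ∃ A ∈ S i, ∃ m, m <:+: l A ∧ ∀ x, x ∈ m ↔ x ∈ B := by
  classical
  intro i
  induction i with
  | zero =>
    intro _
    refine ⟨fun A => (Set.toFinite A).toFinset.toList, fun A _ =>
      ⟨Finset.nodup_toList _, by simp⟩, fun j hj B hB => ?_⟩
    obtain rfl : j = 0 := by omega
    exact ⟨B, hB, _, List.infix_rfl, by simp⟩
  | succ i ih =>
    intro hi
    obtain ⟨l, hl, hl'⟩ := ih (by omega)
    have hP := (isPartition_of_isContraction h0 hS i (by omega)).1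
    obtain ⟨A, hA, B, hB, hAB, hQ⟩ := hS i hi
    have hnot := union_notMem_parts hP hA hB hAB
    -- A merged part is listed by concatenation, so whatever was consecutive stays consecutive.
    have hnew : ∀ C ∈ S (i + 1), (Function.update l (A ∪ B) (l A ++ l B) C).Nodup ∧
        ∀ x, x ∈ Function.update l (A ∪ B) (l A ++ l B) C ↔ x ∈ C := by
      intro C hC
      rw [hQ] at hC
      rcases hC with rfl | hC
      · rw [Function.update_self]
        refine ⟨List.Nodup.append (hl A hA).1 (hl B hB).1 fun x hx hx' => hAB ?_, fun x => ?_⟩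
        · exact eq_of_mem_parts hP hA hB (((hl A hA).2 x).1 hx) (((hl B hB).2 x).1 hx')
        · rw [List.mem_append, (hl A hA).2, (hl B hB).2]
          rfl
      · rw [Function.update_of_ne (by rintro rfl; exact hnot hC.1)]
        exact hl C hC.1
    refine ⟨_, hnew, fun j hj C hC => ?_⟩
    rcases hj.eq_or_lt with rfl | hj
    · exact ⟨C, hC, _, List.infix_rfl, (hnew C hC).2⟩
    · obtain ⟨D, hD, m, hm, hmC⟩ := hl' j (by omega) C hC
      by_cases hDA : D = A
      · refine ⟨A ∪ B, hQ ▸ Or.inl rfl, m, ?_, hmC⟩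
        rw [Function.update_self]
        exact (hDA ▸ hm).trans (List.prefix_append _ _).isInfix
      by_cases hDB : D = B
      · refine ⟨A ∪ B, hQ ▸ Or.inl rfl, m, ?_, hmC⟩
        rw [Function.update_self]
        exact (hDB ▸ hm).trans (List.suffix_append _ _).isInfix
      · refine ⟨D, hQ ▸ Or.inr ⟨hD, by simp [hDA, hDB]⟩, m, ?_, hmC⟩
        rwa [Function.update_of_ne (by rintro rfl; exact hnot hD)]

/-- Some vertex ordering makes every part of every partition of a contraction sequence convex. -/
lemma exists_ordering (h0 : S 0 = Set.range fun x : V => ({x} : Set V))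
    (hS : ∀ i, i + 1 < Fintype.card V → IsContraction (S i) (S (i + 1)))
    (hV : 0 < Fintype.card V) : ∃ v : Fin (Fintype.card V) ≃ V, ∀ j < Fintype.card V,
      ∀ B ∈ S j, ∀ x y z, x ≤ y → y ≤ z → v x ∈ B → v z ∈ B → v y ∈ B := by
  classical
  obtain ⟨l, hl, hl'⟩ := exists_lists h0 hS (Fintype.card V - 1) (by omega)
  have hu := univ_mem_last h0 hS hV
  obtain ⟨hnd, hmem⟩ := hl _ hu
  let e := hnd.getEquivOfForallMemList _ (fun x => (hmem x).2 trivial)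
  have hlen : Fintype.card V = (l Set.univ).length := by
    rw [← Fintype.card_congr e, Fintype.card_fin]
  refine ⟨(finCongr hlen).trans e, fun j hj B hB x y z hxy hyz hx hz => ?_⟩
  obtain ⟨A, hA, m, hm, hmB⟩ := hl' j (by omega) B hB
  obtain rfl : A = Set.univ := by
    have hP := (isPartition_of_isContraction h0 hS (Fintype.card V - 1) (by omega)).1
    obtain ⟨a, ha⟩ := Setoid.nonempty_of_mem_partition hP hA
    exact eq_of_mem_parts hP hA hu ha trivial
  rw [← hmB] at hx hz ⊢
  exact getElem_mem_of_infix hnd hm hxy hyz (hlen ▸ z.2) hx hz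

end Contractions

/-! ### Twin-width bounds almost mixed minors -/

section Blocks

variable {V : Type u} {n d : ℕ}

/-- At most `k` blocks of `r` meet `B`. -/
def MeetsLE (v : Fin n ≃ V) (r : Fin n → Fin d) (B : Set V) (k : ℕ) : Prop :=
  ∃ F : Finset (Fin d), F.card ≤ k ∧ ∀ x, v x ∈ B → r x ∈ F

/-- Some block of `r` is contained in `B`. -/
def ContainsBlock (v : Fin n ≃ V) (r : Fin n → Fin d) (B : Set V) : Prop :=
  ∃ a, ∀ x, r x = a → v x ∈ B

/-- A block strictly between the first and the last block met by a convex set is swallowed by it. -/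
lemma meetsLE_two {v : Fin n ≃ V} {r : Fin n → Fin d} (hr : Monotone r) {B : Set V}
    (hB : ∀ x y z, x ≤ y → y ≤ z → v x ∈ B → v z ∈ B → v y ∈ B)
    (hno : ¬ ContainsBlock v r B) : MeetsLE v r B 2 := by
  classical
  let I : Finset (Fin d) := (Finset.univ.filter fun x => v x ∈ B).image r
  have hI : ∀ x, v x ∈ B → r x ∈ I := fun x hx => Finset.mem_image_of_mem r (by simpa using hx)
  rcases I.eq_empty_or_nonempty with h | h
  · exact ⟨I, by simp [h], hI⟩
  refine ⟨{I.min' h, I.max' h}, Finset.card_le_two, fun x hx => ?_⟩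
  by_contra hx'
  simp only [Finset.mem_insert, Finset.mem_singleton, not_or] at hx'
  have h1 := lt_of_le_of_ne (I.min'_le _ (hI x hx)) (Ne.symm hx'.1)
  have h2 := lt_of_le_of_ne (I.le_max' _ (hI x hx)) hx'.2
  obtain ⟨y, hy, hy'⟩ := Finset.mem_image.1 (I.min'_mem h)
  obtain ⟨z, hz, hz'⟩ := Finset.mem_image.1 (I.max'_mem h)
  rw [← hy'] at h1
  rw [← hz'] at h2
  refine hno ⟨r x, fun w hw => hB y w z ?_ ?_ (by simpa using hy) (by simpa using hz)⟩
  · exact (hr.reflect_lt (hw ▸ h1)).le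
  · exact (hr.reflect_lt (hw ▸ h2)).le

lemma MeetsLE.union {v : Fin n ≃ V} {r : Fin n → Fin d} {A B : Set V} {k l : ℕ}
    (hA : MeetsLE v r A k) (hB : MeetsLE v r B l) : MeetsLE v r (A ∪ B) (k + l) := by
  classical
  obtain ⟨F, hF, hF'⟩ := hA
  obtain ⟨F', hF1, hF1'⟩ := hB
  refine ⟨F ∪ F', (Finset.card_union_le _ _).trans (by omega), ?_⟩
  rintro x (hx | hx)
  · exact Finset.mem_union_left _ (hF' x hx)
  · exact Finset.mem_union_right _ (hF1' x hx)

lemma MeetsLE.mono {v : Fin n ≃ V} {r : Fin n → Fin d} {A : Set V} {k l : ℕ}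
    (hA : MeetsLE v r A k) (h : k ≤ l) : MeetsLE v r A l :=
  hA.imp fun _ hF => ⟨hF.1.trans h, hF.2⟩

/-- If `A` contains the block `a` of `r` and no other block of `c` is homogeneous to it, then
every other block of `c` meets `A` or one of its red neighbours. -/
lemma card_blocks_le [Finite V] {G : SimpleGraph V} {P : Set (Set V)} {t k : ℕ}
    (hcov : ∀ x, ∃ B ∈ P, x ∈ B) (hred : RedDegreeLE G P t) {v : Fin n ≃ V} {r c : Fin n → Fin d}
    (hmeet : ∀ B ∈ P, MeetsLE v c B k) {A : Set V} (hA : A ∈ P) {a : Fin d}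
    (haA : ∀ x, r x = a → v x ∈ A)
    (hmix : ∀ b, b ≠ a → ∃ x x' y, r x = a ∧ r x' = a ∧ c y = b ∧
      (x = y ∨ G.Adj (v x) (v y) ∧ ¬ G.Adj (v x') (v y))) :
    d ≤ k * (t + 1) + 1 := by
  classical
  have hfin : {B ∈ P | B ≠ A ∧ IsRed G A B}.Finite := Set.toFinite _
  choose! F hF hF' using hmeet
  have hsub : (Finset.univ : Finset (Fin d)) ⊆
      insert a ((insert A hfin.toFinset).biUnion F) := by
    intro b _
    by_cases hb : b = a
    · simp [hb]
    obtain ⟨x, x', y, hx, hx', hy, h⟩ := hmix b hb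
    refine Finset.mem_insert_of_mem (Finset.mem_biUnion.2 ?_)
    by_cases hyA : v y ∈ A
    · exact ⟨A, Finset.mem_insert_self _ _, hy ▸ hF' A hA y hyA⟩
    · rcases h with rfl | ⟨h1, h2⟩
      · exact (hyA (haA _ hx)).elim
      obtain ⟨B, hB, hyB⟩ := hcov (v y)
      refine ⟨B, Finset.mem_insert_of_mem (hfin.mem_toFinset.2 ⟨hB, ?_, ?_⟩), hy ▸ hF' B hB y hyB⟩
      · rintro rfl
        exact hyA hyB
      · exact ⟨⟨_, haA x hx, _, hyB, h1⟩, ⟨_, haA x' hx', _, hyB, h2⟩⟩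
  have h1 := Finset.card_le_card hsub
  rw [Finset.card_univ, Fintype.card_fin] at h1
  have h2 : ((insert A hfin.toFinset).biUnion F).card ≤ (insert A hfin.toFinset).card * k := by
    refine Finset.card_biUnion_le_card_mul _ _ _ fun B hB => ?_
    rcases Finset.mem_insert.1 hB with rfl | hB
    · exact hF _ hA
    · exact hF _ (hfin.mem_toFinset.1 hB).1
  have h3 : (insert A hfin.toFinset).card ≤ t + 1 := by
    refine (Finset.card_insert_le _ _).trans (Nat.add_le_add_right ?_ 1)
    rw [← Set.ncard_eq_toFinset_card _ hfin]
    exact hred A hA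
  have h4 := Finset.card_insert_le a ((insert A hfin.toFinset).biUnion F)
  nlinarith [Nat.mul_le_mul_right k h3]

lemma orderedAdjMatrix_symm (G : SimpleGraph V) (v : Fin n ≃ V) (i j : Fin n) :
    orderedAdjMatrix G v i j = orderedAdjMatrix G v j i := by
  simp only [orderedAdjMatrix, eq_comm (a := i)]
  congr 2
  exact propext (G.adj_comm (v i) (v j))

/-- Both ways of being mixed are brought to one form: a `*` is a vertex common to the row and column
blocks, and without one, two different entries of a column are an edge and a non-edge. -/
lemma exists_of_not_vertical {G : SimpleGraph V} {v : Fin n ≃ V} {r c : Fin n → Fin d} {a b : Fin d}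
    (h : (∃ x x' y, r x = a ∧ r x' = a ∧ c y = b ∧
      orderedAdjMatrix G v x y ≠ orderedAdjMatrix G v x' y) ∨
      ∃ x y, r x = a ∧ c y = b ∧ orderedAdjMatrix G v x y = Entry.star) :
    ∃ x x' y, r x = a ∧ r x' = a ∧ c y = b ∧
      (x = y ∨ G.Adj (v x) (v y) ∧ ¬ G.Adj (v x') (v y)) := by
  have hstar : ∀ x y, orderedAdjMatrix G v x y = Entry.star → x = y := by
    intro x y h
    by_contra hne
    simp only [orderedAdjMatrix, hne, if_false] at h
    split_ifs at h
  rcases h with ⟨x, x', y, hx, hx', hy, h⟩ | ⟨x, y, hx, hy, h⟩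
  · by_cases h1 : x = y
    · exact ⟨x, x, y, hx, hx, hy, Or.inl h1⟩
    by_cases h2 : x' = y
    · exact ⟨x', x', y, hx', hx', hy, Or.inl h2⟩
    simp only [orderedAdjMatrix, h1, h2, if_false] at h
    by_cases h3 : G.Adj (v x) (v y) <;> by_cases h4 : G.Adj (v x') (v y)
    · simp [h3, h4] at h
    · exact ⟨x, x', y, hx, hx', hy, Or.inr ⟨h3, h4⟩⟩
    · exact ⟨x', x, y, hx', hx, hy, Or.inr ⟨h4, h3⟩⟩
    · simp [h3, h4] at h
  · exact ⟨x, x, y, hx, hx, hy, Or.inl (hstar x y h)⟩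

lemma exists_of_isMixed_zone {G : SimpleGraph V} {v : Fin n ≃ V} {D : Division n n d} {a b : Fin d}
    (h : IsMixed (D.zone (orderedAdjMatrix G v) a b)) :
    (∃ x x' y, D.rows.block x = a ∧ D.rows.block x' = a ∧ D.cols.block y = b ∧
      (x = y ∨ G.Adj (v x) (v y) ∧ ¬ G.Adj (v x') (v y))) ∧
    ∃ x x' y, D.cols.block x = b ∧ D.cols.block x' = b ∧ D.rows.block y = a ∧
      (x = y ∨ G.Adj (v x) (v y) ∧ ¬ G.Adj (v x') (v y)) := by
  rcases h with ⟨h1, h2⟩ | ⟨-, -, ⟨x, hx⟩, ⟨y, hy⟩, h⟩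
  · constructor <;> apply exists_of_not_vertical <;> left
    · simp only [IsVertical, not_forall] at h2
      obtain ⟨⟨x, hx⟩, ⟨x', hx'⟩, ⟨y, hy⟩, h⟩ := h2
      exact ⟨x, x', y, hx, hx', hy, h⟩
    · simp only [IsHorizontal, not_forall] at h1
      obtain ⟨⟨y, hy⟩, ⟨x, hx⟩, ⟨x', hx'⟩, h⟩ := h1
      refine ⟨x, x', y, hx, hx', hy, ?_⟩
      rwa [orderedAdjMatrix_symm G v x, orderedAdjMatrix_symm G v x']
  · constructor <;> apply exists_of_not_vertical <;> right
    · exact ⟨x, y, hx, hy, h⟩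
    · exact ⟨y, x, hy, hx, (orderedAdjMatrix_symm G v y x).trans h⟩

end Blocks

/-- Graphs of twin-width at most `t` are `(4 * t + 6)`-almost mixed free. -/
theorem TwinWidthLE.graphAlmostMixedFree {V : Type u} [Fintype V] {G : SimpleGraph V} {t : ℕ}
    (h : TwinWidthLE G t) : GraphAlmostMixedFree (4 * t + 6) G := by
  classical
  obtain ⟨P, h0, hstep, hred⟩ := h
  rcases (Fintype.card V).eq_zero_or_pos with hV | hV
  · refine ⟨(Fintype.equivFin V).symm, fun D _ => ?_⟩
    obtain ⟨x, -⟩ := D.rows.surjective_block ⟨0, by omega⟩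
    exact absurd x.2 (by omega)
  obtain ⟨v, hv⟩ := exists_ordering h0 hstep hV
  refine ⟨v, fun D hD => ?_⟩
  -- The last partition has the part `univ`, so there is a first partition with a part that contains
  -- a block.
  have hex : ∃ s, s < Fintype.card V ∧
      ∃ A ∈ P s, ContainsBlock v D.rows.block A ∨ ContainsBlock v D.cols.block A :=
    ⟨_, Nat.sub_one_lt_of_lt hV, _, univ_mem_last h0 hstep hV,
      Or.inl ⟨⟨0, by omega⟩, fun _ _ => trivial⟩⟩
  obtain ⟨hs, A, hA, hAblock⟩ := Nat.find_spec hex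
  have hmin := fun m => Nat.find_min hex (m := m)
  generalize Nat.find hex = s at hs hA hmin
  -- Just before, each part met at most 2 blocks, and a single merge at most doubles this.
  have hmeet : ∀ r : IntervalPartition (Fintype.card V) (4 * t + 6), r = D.rows ∨ r = D.cols →
      ∀ B ∈ P s, MeetsLE v r.block B 4 := by
    intro r hr B hB
    rcases s with _ | s
    · rw [h0] at hB
      obtain ⟨x, rfl⟩ := hB
      refine ⟨{r.block (v.symm x)}, by simp, ?_⟩
      rintro y rfl
      simp
    · have htwo : ∀ C ∈ P s, MeetsLE v r.block C 2 := by
        refine fun C hC => meetsLE_two r.monotone_block (hv s (by omega) C hC) fun hno => ?_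
        refine hmin s (by omega) ⟨by omega, C, hC, ?_⟩
        rcases hr with rfl | rfl
        · exact Or.inl hno
        · exact Or.inr hno
      obtain ⟨C, hC, C', hC', -, hQ⟩ := hstep s hs
      rw [hQ] at hB
      rcases hB with rfl | hB
      · exact (htwo C hC).union (htwo C' hC')
      · exact (htwo B hB.1).mono (by omega)
  have hcov : ∀ x, ∃ B ∈ P s, x ∈ B := fun x =>
    ((isPartition_of_isContraction h0 hstep s hs).1.2 x).exists
  have hle : 4 * t + 6 ≤ 4 * (t + 1) + 1 := by
    rcases hAblock with ⟨a, ha⟩ | ⟨a, ha⟩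
    · exact card_blocks_le hcov (hred s hs) (hmeet _ (Or.inr rfl)) hA ha
        fun b hb => (exists_of_isMixed_zone (hD a b hb.symm)).1
    · exact card_blocks_le hcov (hred s hs) (hmeet _ (Or.inl rfl)) hA ha
        fun b hb => (exists_of_isMixed_zone (hD b a hb)).2
  omega

end AlmostMixed

theorem mainTheorem1 :
    (∃ k : ℕ → ℕ, (∃ C : ℕ, ∀ d : ℕ, 1 ≤ d → k d ≤ d ^ (C * d)) ∧
      ∀ d : ℕ, 1 ≤ d → ∀ (V : Type u) [Fintype V] (G : SimpleGraph V),
        AlmostMixed.GraphAlmostMixedFree d G →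
          G.chromaticNumber ≤ ((G.cliqueNum ^ k d : ℕ) : ℕ∞)) ∧
    (∀ t : ℕ, ∃ k : ℕ, ∀ (V : Type u) [Fintype V] (G : SimpleGraph V),
      AlmostMixed.TwinWidthLE G t →
        G.chromaticNumber ≤ ((G.cliqueNum ^ k : ℕ) : ℕ∞)) := by
  refine ⟨⟨AlmostMixed.boundingExponent, ⟨15, fun d _ => AlmostMixed.boundingExponent_le d⟩,
    fun d hd V _ G h => AlmostMixed.chromaticNumber_le_cliqueNum_pow hd h⟩,
    fun t => ⟨AlmostMixed.boundingExponent (4 * t + 6), fun V _ G h =>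
      AlmostMixed.chromaticNumber_le_cliqueNum_pow (by omega) h.graphAlmostMixedFree⟩⟩
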